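/- Let $(M^n,J,g)$ be a compact Hermitian manifold of complex dimension $n$: a compact smooth $2n$-manifold with an integrable complex structure $J$ and a smooth $J$-compatible Riemannian metric $g$, with Kähler form $\omega=g(J\cdot,\cdot)$. The Chern connection $\nabla$ is the unique connection with $\nabla g=0$, $\nabla J=0$ whose torsion has no $(1,1)$-part; let $R$ be its curvature, $R(X,Y,Z,W)=g(R(X,Y)Z,W)$ extended complex multilinearly. The Bismut connection $\nabla^b$ is the unique connection with $\nabla^b g=0$, $\nabla^b J=0$ whose torsion $T^b$ is totally skew-symmetric. The metric $g$ is called Bismut torsion-parallel (BTP) if $\nabla^bT^b=0$, and balanced if $d(\omega^{n-1})=0$. For $\alpha,\beta\in\mathbb R$ the mixed curvature at a type $(1,0)$ tangent vector $X$ of unit length is $$\mathcal C_{\alpha,\beta}(X)=\alpha\sum_{i=1}^n R(X,\overline X,e_i,\overline e_i)+\beta\,R(X,\overline X,X,\overline X),$$ where $e_1,\dots,e_n$ is any unitary frame of type $(1,0)$ vectors (the sum is the first Chern Ricci curvature, the second term the holomorphic sectional curvature). Theorem. Suppose that $g$ is BTP and not balanced, and that for some real numbers $\alpha,\beta,c$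 one has $\mathcal C_{\alpha,\beta}(X)=c$ for all unit type $(1,0)$ tangent vectors $X$ at all points of $M$. Then $c=0$. -/

import Mathlib

open Bundle Manifold
open scoped ContDiff

noncomputable section

namespace HermitianGeometry

section Smooth

variable {E : Type*} [NormedAddCommGroup E] [NormedSpace ℝ E]
  {M : Type*} [TopologicalSpace M] [ChartedSpace E M] [IsManifold 𝓘(ℝ, E) ∞ M]

/-- The vector field `X` is differentiable at `x`. -/
def DiffAt (X : Π x : M, TangentSpace 𝓘(ℝ, E) x) (x : M) : Prop :=
  MDifferentiableAt 𝓘(ℝ, E) (𝓘(ℝ, E).prod 𝓘(ℝ, E))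
    (fun y ↦ (⟨y, X y⟩ : TotalSpace E (fun y : M ↦ TangentSpace 𝓘(ℝ, E) y))) x

/-- An affine connection, i.e. a covariant derivative on the tangent bundle.
`D Y x u` is `(∇_u Y)(x)`. -/
abbrev Connection (E : Type*) [NormedAddCommGroup E] [NormedSpace ℝ E]
    (M : Type*) [TopologicalSpace M] [ChartedSpace E M] [IsManifold 𝓘(ℝ, E) ∞ M] :=
  CovariantDerivative 𝓘(ℝ, E) E (fun x : M ↦ TangentSpace 𝓘(ℝ, E) x)

variable [FiniteDimensional ℝ E]

/-- A complex structure on a smooth manifold: a smooth field `J` of endomorphisms of the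
tangent bundle with `J² = -1` whose Nijenhuis tensor vanishes. -/
structure ComplexStructure (E : Type*) [NormedAddCommGroup E] [NormedSpace ℝ E]
    (M : Type*) [TopologicalSpace M] [ChartedSpace E M] [IsManifold 𝓘(ℝ, E) ∞ M] where
  J : Π x : M, TangentSpace 𝓘(ℝ, E) x →L[ℝ] TangentSpace 𝓘(ℝ, E) x
  smooth : ContMDiff 𝓘(ℝ, E) (𝓘(ℝ, E).prod 𝓘(ℝ, E →L[ℝ] E)) ∞
    (fun x ↦ (⟨x, J x⟩ :
      TotalSpace (E →L[ℝ] E) (fun x : M ↦ TangentSpace 𝓘(ℝ, E) x →L[ℝ] TangentSpace 𝓘(ℝ, E) x)))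
  sq : ∀ (x : M) (u : TangentSpace 𝓘(ℝ, E) x), J x (J x u) = -u
  integrable : ∀ (X Y : Π x : M, TangentSpace 𝓘(ℝ, E) x) (x : M), DiffAt X x → DiffAt Y x →
    VectorField.mlieBracket 𝓘(ℝ, E) X Y x
      - VectorField.mlieBracket 𝓘(ℝ, E) (fun y ↦ J y (X y)) (fun y ↦ J y (Y y)) x
      + J x (VectorField.mlieBracket 𝓘(ℝ, E) (fun y ↦ J y (X y)) Y x)
      + J x (VectorField.mlieBracket 𝓘(ℝ, E) X (fun y ↦ J y (Y y)) x) = 0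

/-- `∇J = 0`, i.e. `∇_u (J Y) = J (∇_u Y)`. -/
def ParallelComplexStructure (S : ComplexStructure E M) (D : Connection E M) : Prop :=
  ∀ (Y : Π x : M, TangentSpace 𝓘(ℝ, E) x) (x : M), DiffAt Y x → ∀ u : TangentSpace 𝓘(ℝ, E) x,
    D (fun y ↦ S.J y (Y y)) x u = S.J x (D Y x u)

/-- `∇T = 0` for the torsion `T` of `∇`, i.e.
`∇_u (T(Y, Z)) = T(∇_u Y, Z) + T(Y, ∇_u Z)`. -/
def ParallelTorsion (D : Connection E M) : Prop :=
  ∀ (Y Z : Π x : M, TangentSpace 𝓘(ℝ, E) x) (x : M), DiffAt Y x → DiffAt Z x →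
    ∀ u : TangentSpace 𝓘(ℝ, E) x, D (fun y ↦ D.torsion y (Y y) (Z y)) x u
      = D.torsion x (D Y x u) (Z x) + D.torsion x (Y x) (D Z x u)

/-- The curvature `R(X, Y)Z = ∇_X ∇_Y Z - ∇_Y ∇_X Z - ∇_[X,Y] Z` on vector fields. -/
def curvatureField (D : Connection E M) (X Y Z : Π x : M, TangentSpace 𝓘(ℝ, E) x) (x : M) :
    TangentSpace 𝓘(ℝ, E) x :=
  D (fun y ↦ D Z y (Y y)) x (X x) - D (fun y ↦ D Z y (X y)) x (Y x)
    - D Z x (VectorField.mlieBracket 𝓘(ℝ, E) X Y x)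

/-- The value `R(u, v)w` of the curvature tensor on tangent vectors at `x`, computed with the
vector fields which extend `u, v, w` with constant coefficients in the chart at `x`. -/
def curvature (D : Connection E M) (x : M) (u v w : TangentSpace 𝓘(ℝ, E) x) :
    TangentSpace 𝓘(ℝ, E) x :=
  curvatureField D (FiberBundle.extend E u) (FiberBundle.extend E v)
    (FiberBundle.extend E w) x

/-- The exterior derivative at `x` of a differential `k`-form `a`, in the chart at `x`:
`(da)(v₀, …, v_k) = ∑ i, (-1)ⁱ v_i (a(V₀, …, V̂_i, …, V_k))`, where `V_j` is the vector field with
constant coefficients in the chart at `x` and value `v_j` at `x`. -/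
def extDerivAt {k : ℕ} (a : Π x : M, (Fin k → TangentSpace 𝓘(ℝ, E) x) → ℝ) (x : M)
    (v : Fin (k + 1) → TangentSpace 𝓘(ℝ, E) x) : ℝ :=
  ∑ i : Fin (k + 1), (-1 : ℝ) ^ (i : ℕ) *
    mvfderiv 𝓘(ℝ, E)
      (fun y : M ↦ a y (fun j ↦ FiberBundle.extend E (v (i.succAbove j)) y)) x (v i)

end Smooth

/-- The `k`-th exterior power `w ∧ ⋯ ∧ w` of an alternating bilinear form `w`. -/
def wedgePow {V : Type*} (w : V → V → ℝ) (k : ℕ) (v : Fin (2 * k) → V) : ℝ :=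
  (1 / 2 : ℝ) ^ k * ∑ σ : Equiv.Perm (Fin (2 * k)), ((Equiv.Perm.sign σ : ℤ) : ℝ) *
    ∏ i : Fin k, w (v (σ ⟨2 * i, by omega⟩)) (v (σ ⟨2 * i + 1, by omega⟩))

section Hermitian

variable {E : Type*} [NormedAddCommGroup E] [NormedSpace ℝ E]
  {M : Type*} [TopologicalSpace M] [ChartedSpace E M] [IsManifold 𝓘(ℝ, E) ∞ M]

/-- A smooth Riemannian metric `g` on `M`; `g.inner x u v` is `g_x(u, v)`. -/
abbrev Metric (E : Type*) [NormedAddCommGroup E] [NormedSpace ℝ E]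
    (M : Type*) [TopologicalSpace M] [ChartedSpace E M] [IsManifold 𝓘(ℝ, E) ∞ M] :=
  ContMDiffRiemannianMetric 𝓘(ℝ, E) ∞ E (fun x : M ↦ TangentSpace 𝓘(ℝ, E) x)

/-- The metric `g` is Hermitian, i.e. compatible with the complex structure. -/
def IsHermitian (S : ComplexStructure E M) (g : Metric E M) : Prop :=
  ∀ (x : M) (u v : TangentSpace 𝓘(ℝ, E) x), g.inner x (S.J x u) (S.J x v) = g.inner x u v

/-- The Kähler form `ω(u, v) = g(Ju, v)`. -/
def kahlerForm (S : ComplexStructure E M) (g : Metric E M) (x : M)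
    (u v : TangentSpace 𝓘(ℝ, E) x) : ℝ :=
  g.inner x (S.J x u) v

/-- The metric is balanced, `n` being the complex dimension: `d(ωⁿ⁻¹) = 0`. -/
def IsBalanced (n : ℕ) (S : ComplexStructure E M) (g : Metric E M) : Prop :=
  ∀ (x : M) (v : Fin (2 * (n - 1) + 1) → TangentSpace 𝓘(ℝ, E) x),
    extDerivAt (fun y ↦ wedgePow (kahlerForm S g y) (n - 1)) x v = 0

/-- `∇g = 0`, i.e. `u (g(Y, Z)) = g(∇_u Y, Z) + g(Y, ∇_u Z)`. -/
def ParallelMetric (g : Metric E M) (D : Connection E M) : Prop :=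
  ∀ (Y Z : Π x : M, TangentSpace 𝓘(ℝ, E) x) (x : M), DiffAt Y x → DiffAt Z x →
    ∀ u : TangentSpace 𝓘(ℝ, E) x,
      mvfderiv 𝓘(ℝ, E) (fun y ↦ g.inner y (Y y) (Z y)) x u
        = g.inner x (D Y x u) (Z x) + g.inner x (Y x) (D Z x u)

variable [FiniteDimensional ℝ E]

/-- `D` is the Chern connection: the smooth connection with `∇g = 0`, `∇J = 0` and torsion
without `(1,1)`-part. The latter means `T(u - iJu, v + iJv) = 0` for the complex bilinear
extension of `T`, i.e. `T(Ju, v) = T(u, Jv)`. -/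
structure IsChern (S : ComplexStructure E M) (g : Metric E M) (D : Connection E M) : Prop where
  smooth : D.ContMDiffCovariantDerivative ∞
  metric : ParallelMetric g D
  complex : ParallelComplexStructure S D
  torsion : ∀ (x : M) (u v : TangentSpace 𝓘(ℝ, E) x),
    D.torsion x (S.J x u) v = D.torsion x u (S.J x v)

/-- `D` is the Bismut connection: the smooth connection with `∇g = 0`, `∇J = 0` and totally
skew-symmetric torsion. -/
structure IsBismut (S : ComplexStructure E M) (g : Metric E M) (D : Connection E M) : Prop where
  smooth : D.ContMDiffCovariantDerivative ∞
  metric : ParallelMetric g D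
  complex : ParallelComplexStructure S D
  torsion : ∀ (x : M) (u v w : TangentSpace 𝓘(ℝ, E) x),
    g.inner x (D.torsion x u v) w = -g.inner x (D.torsion x u w) v

/-- Bismut torsion-parallel: the Bismut connection has parallel torsion. -/
def IsBTP (S : ComplexStructure E M) (g : Metric E M) : Prop :=
  ∃ D : Connection E M, IsBismut S g D ∧ ParallelTorsion D

/-- `e₁, …, e_n` gives a unitary frame at `x`: the type `(1,0)` vectors `(e_i - iJe_i)/√2` are
unitary, i.e. `e₁, Je₁, …, e_n, Je_n` are orthonormal. -/
def IsUnitaryFrame {n : ℕ} (S : ComplexStructure E M) (g : Metric E M) (x : M)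
    (e : Fin n → TangentSpace 𝓘(ℝ, E) x) : Prop :=
  ∀ i j, g.inner x (e i) (e j) = (if i = j then 1 else 0) ∧ g.inner x (e i) (S.J x (e j)) = 0

/-- `R(X, X̄, Y, Ȳ) = g(R(X, X̄)Y, Ȳ)`, with `R` and `g` extended complex multilinearly, for the
type `(1,0)` vectors `X = (u - iJu)/√2` and `Y = (w - iJw)/√2`, which have the lengths of `u`
and `w`. As `R(X, X̄) = i R(u, Ju)` and `g(R(u, Ju)Y, Ȳ) = i g(R(u, Ju)w, Jw)`, this is
`-g(R(u, Ju)w, Jw) = g(R(u, Ju)Jw, w)`, since `∇J = 0` and `∇g = 0`. -/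
def bisectional (S : ComplexStructure E M) (g : Metric E M) (D : Connection E M) (x : M)
    (u w : TangentSpace 𝓘(ℝ, E) x) : ℝ :=
  g.inner x (curvature D x u (S.J x u) (S.J x w)) w

/-- The mixed curvature `α Ric(X, X̄) + β H(X)` of the connection `D` at the unit vector
`X = (u - iJu)/√2`; here `Ric(X, X̄) = ∑ i, R(X, X̄, e_i, ē_i)` is the first Ricci curvature,
computed with the unitary frame `e`, and `H(X) = R(X, X̄, X, X̄)` is the holomorphic sectional
curvature. -/
def mixedCurvature {n : ℕ} (S : ComplexStructure E M) (g : Metric E M) (D : Connection E M)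
    (α β : ℝ) (x : M) (e : Fin n → TangentSpace 𝓘(ℝ, E) x) (u : TangentSpace 𝓘(ℝ, E) x) : ℝ :=
  α * ∑ i, bisectional S g D x u (e i) + β * bisectional S g D x u u

/-- The mixed curvature of the Chern connection, in complex dimension `n`, is constantly equal
to `c`: at every point, for every unit vector, and with every unitary frame. -/
def HasConstantMixedCurvature (n : ℕ) (S : ComplexStructure E M) (g : Metric E M)
    (α β c : ℝ) : Prop :=
  ∃ D : Connection E M, IsChern S g D ∧
    ∀ (x : M) (e : Fin n → TangentSpace 𝓘(ℝ, E) x) (u : TangentSpace 𝓘(ℝ, E) x),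
      IsUnitaryFrame S g x e → g.inner x u u = 1 → mixedCurvature S g D α β x e u = c

end Hermitian

end HermitianGeometry

end

/-! Let `T` be the Bismut torsion and `ξ = ∑ T(e_i, Je_i)` the Lee vector. If `ξ` vanishes
everywhere then `g` is balanced (`isBalanced_of_leeVector_eq_zero`), so a non-balanced metric has a
point with `ξ ≠ 0`. There the Chern Ricci and the holomorphic sectional curvature both vanish in the
direction of `ξ` (`chern_leeVector`), whence `c = 0`. The argument is pointwise.

Vanishing of the curvature. The endomorphisms `R(u, v)` of the Bismut curvature commute with `J` and
act as derivations of the parallel torsion. The first Bianchi identity then involves only `T` on its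
right side, and yields pair symmetry and `R(Ju, Jv) = R(u, v)`. Two consequences follow by taking
traces of commutators, since `g(Jξ, u)` is the trace of the Chern torsion operator `[u, ·]`. The
derivation property gives `R(u, v)ξ = 0`, hence `R(ξ, ·) = 0`. The Bianchi identity makes the Chern
torsion a Lie bracket, so `ξ` and `Jξ` are orthogonal to all brackets, and this gives `T(ξ, Jξ) =
0`. With `A_u` the difference of the Chern and Bismut connections, the Chern curvature is `R(u, v) +
A_{T(u, v)} + [A_u, A_v]`. For `u` proportional to `ξ` and `v = Ju` only the commutator is left. It
kills `u`, and its complex trace is zero.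

Balancedness. As `ω` is Bismut-parallel, `d(ωⁿ⁻¹)` is an alternating sum of contractions of `ωⁿ⁻¹`
with `T`. Evaluated on a unitary frame without `e₀`, it is a multiple of `g(ξ, e₀)`. -/

noncomputable section

namespace HermitianGeometry

open Filter Topology

/-! ### Hermitian linear algebra and unitary frames. -/

section LinearAlgebra

variable {V : Type*} [AddCommGroup V] [Module ℝ V]

/-- A Hermitian vector space: a scalar product `g` and a compatible complex structure `J`. -/
structure HermitianPair (g : V →ₗ[ℝ] V →ₗ[ℝ] ℝ) (J : V →ₗ[ℝ] V) : Prop where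
  symm : ∀ u v, g u v = g v u
  pos : ∀ u, u ≠ 0 → 0 < g u u
  sq : ∀ u, J (J u) = -u
  inner_J : ∀ u v, g (J u) (J v) = g u v

/-- The vectors `e₁, Je₁, …, e_k, Je_k` are orthonormal. -/
def UnitaryFamily (g : V →ₗ[ℝ] V →ₗ[ℝ] ℝ) (J : V →ₗ[ℝ] V) {k : ℕ} (e : Fin k → V) : Prop :=
  ∀ i j, g (e i) (e j) = (if i = j then 1 else 0) ∧ g (e i) (J (e j)) = 0

variable {g : V →ₗ[ℝ] V →ₗ[ℝ] ℝ} {J : V →ₗ[ℝ] V}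

namespace HermitianPair

variable (h : HermitianPair g J)
include h

lemma inner_J_left (u v : V) : g (J u) v = -g u (J v) := by
  rw [← h.inner_J u (J v), h.sq]; simp

lemma inner_J_self (u : V) : g u (J u) = 0 := by
  have h1 := h.inner_J_left u u
  rw [h.symm] at h1
  linarith

lemma eq_of_inner {u v : V} (huv : ∀ w, g u w = g v w) : u = v := by
  by_contra hne
  have h1 := h.pos (u - v) (sub_ne_zero.2 hne)
  simp only [map_sub, LinearMap.sub_apply] at h1
  linarith [huv u, huv v]

lemma eq_zero_of_inner {u : V} (hu : ∀ w, g u w = 0) : u = 0 :=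
  h.eq_of_inner fun w ↦ by simp [hu]

lemma J_eq_zero {u : V} (hu : J u = 0) : u = 0 := by
  have := h.sq u
  rw [hu, map_zero] at this
  exact neg_eq_zero.1 this.symm

/-- The orthonormal family `e₁, …, e_k, Je₁, …, Je_k` is orthonormal for `g`. -/
lemma inner_sumElim {k : ℕ} {e : Fin k → V} (he : UnitaryFamily g J e) (a b : Fin k ⊕ Fin k) :
    g (Sum.elim e (J ∘ e) a) (Sum.elim e (J ∘ e) b) = if a = b then 1 else 0 := by
  rcases a with i | i <;> rcases b with j | j
  · simpa using (he i j).1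
  · simpa using (he i j).2
  · simp [h.inner_J_left, (he i j).2]
  · simpa [h.inner_J] using (he i j).1

lemma linearIndependent {k : ℕ} {e : Fin k → V} (he : UnitaryFamily g J e) :
    LinearIndependent ℝ (Sum.elim e (J ∘ e)) := by
  rw [Fintype.linearIndependent_iff]
  intro c hc a
  have h1 := congrArg (fun v ↦ g v (Sum.elim e (J ∘ e) a)) hc
  simpa [map_sum, LinearMap.sum_apply, h.inner_sumElim he, -Fintype.sum_sum_type] using h1

/-- The real basis attached to a unitary frame. -/
def frameBasis [FiniteDimensional ℝ V] {n : ℕ} (hn : Module.finrank ℝ V = 2 * n) {e : Fin n → V}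
    (he : UnitaryFamily g J e) : Module.Basis (Fin n ⊕ Fin n) ℝ V :=
  basisOfLinearIndependentOfCardEqFinrank' _ (h.linearIndependent he) (by simp [hn]; ring)

lemma coe_frameBasis [FiniteDimensional ℝ V] {n : ℕ} (hn : Module.finrank ℝ V = 2 * n)
    {e : Fin n → V} (he : UnitaryFamily g J e) :
    ⇑(h.frameBasis hn he) = Sum.elim e (J ∘ e) := by
  simp [frameBasis]

lemma frameBasis_repr [FiniteDimensional ℝ V] {n : ℕ} (hn : Module.finrank ℝ V = 2 * n)
    {e : Fin n → V} (he : UnitaryFamily g J e) (u : V) (a : Fin n ⊕ Fin n) :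
    (h.frameBasis hn he).repr u a = g u (Sum.elim e (J ∘ e) a) := by
  conv_rhs => rw [← (h.frameBasis hn he).sum_repr u]
  simp [map_sum, LinearMap.sum_apply, h.inner_sumElim he, h.coe_frameBasis hn he,
    -Fintype.sum_sum_type]

lemma sum_frame [FiniteDimensional ℝ V] {n : ℕ} (hn : Module.finrank ℝ V = 2 * n)
    {e : Fin n → V} (he : UnitaryFamily g J e) (u : V) :
    u = ∑ i, (g u (e i) • e i + g u (J (e i)) • J (e i)) := by
  conv_lhs => rw [← (h.frameBasis hn he).sum_repr u]
  simp [h.frameBasis_repr, h.coe_frameBasis, Finset.sum_add_distrib]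

lemma trace_eq_sum [FiniteDimensional ℝ V] {n : ℕ} (hn : Module.finrank ℝ V = 2 * n)
    {e : Fin n → V} (he : UnitaryFamily g J e) (L : V →ₗ[ℝ] V) :
    LinearMap.trace ℝ V L = ∑ i, (g (L (e i)) (e i) + g (L (J (e i))) (J (e i))) := by
  rw [LinearMap.trace_eq_matrix_trace ℝ (h.frameBasis hn he), Matrix.trace]
  simp [LinearMap.toMatrix_apply, h.frameBasis_repr, h.coe_frameBasis, Finset.sum_add_distrib]

/-- Some unit vector is orthogonal to a given family of fewer vectors than the dimension. -/
lemma exists_unit_orthogonal [FiniteDimensional ℝ V] {ι : Type*} [Fintype ι] (v : ι → V)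
    (hι : Fintype.card ι < Module.finrank ℝ V) : ∃ f, g f f = 1 ∧ ∀ i, g f (v i) = 0 := by
  have h1 := LinearMap.ker_ne_bot_of_finrank_lt (f := LinearMap.pi fun i ↦ g.flip (v i))
    (by simpa using hι)
  obtain ⟨w, hw, hw0⟩ := (Submodule.ne_bot_iff _).1 h1
  have hw' : ∀ i, g w (v i) = 0 := fun i ↦ congrFun (LinearMap.mem_ker.1 hw) i
  have hp := h.pos w hw0
  refine ⟨(Real.sqrt (g w w))⁻¹ • w, ?_, fun i ↦ by simp [hw' i]⟩
  have := Real.mul_self_sqrt hp.le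
  have h2 : Real.sqrt (g w w) ≠ 0 := (Real.sqrt_pos.2 hp).ne'
  simp only [map_smul, LinearMap.smul_apply, smul_eq_mul]
  field_simp
  nlinarith

/-- A unitary family can be extended by one vector. -/
lemma unitaryFamily_snoc {k : ℕ} {e : Fin k → V} (he : UnitaryFamily g J e) {f : V}
    (hf : g f f = 1) (hfe : ∀ i, g f (e i) = 0) (hfJ : ∀ i, g f (J (e i)) = 0) :
    UnitaryFamily g J (Fin.snoc e f : Fin (k + 1) → V) := by
  intro i j
  induction i using Fin.lastCases with
  | last =>
    induction j using Fin.lastCases with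
    | last => simp [hf, h.inner_J_self]
    | cast j => simp [hfe, hfJ, (Fin.castSucc_lt_last j).ne']
  | cast i =>
    induction j using Fin.lastCases with
    | last =>
      have := h.inner_J_left (e i) f
      rw [h.symm, hfJ] at this
      simp [(Fin.castSucc_lt_last i).ne, h.symm (e i) f, hfe]
      linarith
    | cast j => simpa using he i j

/-- Every unit vector is the first vector of a unitary frame. -/
lemma exists_unitaryFamily [FiniteDimensional ℝ V] {n : ℕ} (hn : Module.finrank ℝ V = 2 * n)
    {f : V} (hf : g f f = 1) {k : ℕ} (hk : k + 1 ≤ n) :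
    ∃ e : Fin (k + 1) → V, UnitaryFamily g J e ∧ e 0 = f := by
  induction k with
  | zero => exact ⟨fun _ ↦ f, fun i j ↦ ⟨by simp [hf, show i = j from Fin.ext (by omega)],
      h.inner_J_self f⟩, rfl⟩
  | succ k ih =>
    obtain ⟨e, he, he0⟩ := ih (by omega)
    obtain ⟨w, hw, hwe⟩ := h.exists_unit_orthogonal (Sum.elim e (J ∘ e)) (by simp; omega)
    refine ⟨Fin.snoc e w, h.unitaryFamily_snoc he hw (fun i ↦ by simpa using hwe (.inl i))
      (fun i ↦ by simpa using hwe (.inr i)), ?_⟩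
    rw [← he0, ← Fin.castSucc_zero, Fin.snoc_castSucc]

end HermitianPair

/-! ### Algebra of the Bismut and Chern torsions at a point. -/

/-- The algebraic properties of the torsion of the Bismut connection. -/
structure BismutTorsion (g : V →ₗ[ℝ] V →ₗ[ℝ] ℝ) (J : V →ₗ[ℝ] V) (T : V →ₗ[ℝ] V →ₗ[ℝ] V) :
    Prop where
  antisymm : ∀ u v, T u v = -T v u
  skew : ∀ u v w, g (T u v) w = -g (T u w) v
  nijenhuis : ∀ u v, T u v - T (J u) (J v) + J (T (J u) v) + J (T u (J v)) = 0

/-- The difference of the Chern and the Bismut connection. -/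
def chernDifference (J : V →ₗ[ℝ] V) (T : V →ₗ[ℝ] V →ₗ[ℝ] V) (u v : V) : V :=
  (-(1 / 2) : ℝ) • (T u v - J (T u (J v)))

lemma chernDifference_sub_left (J : V →ₗ[ℝ] V) (T : V →ₗ[ℝ] V →ₗ[ℝ] V) (u v w : V) :
    chernDifference J T (u - v) w = chernDifference J T u w - chernDifference J T v w := by
  simp only [chernDifference, map_sub, LinearMap.sub_apply]
  module

lemma chernDifference_add_right (J : V →ₗ[ℝ] V) (T : V →ₗ[ℝ] V →ₗ[ℝ] V) (u v w : V) :
    chernDifference J T u (v + w) = chernDifference J T u v + chernDifference J T u w := by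
  simp only [chernDifference, map_add]
  module

/-- The torsion of the Chern connection, in terms of that of the Bismut connection. -/
def chernTorsion (J : V →ₗ[ℝ] V) (T : V →ₗ[ℝ] V →ₗ[ℝ] V) : V →ₗ[ℝ] V →ₗ[ℝ] V :=
  (1 / 2 : ℝ) • (T.compl₁₂ J J - T)

lemma chernTorsion_apply (J : V →ₗ[ℝ] V) (T : V →ₗ[ℝ] V →ₗ[ℝ] V) (u v : V) :
    chernTorsion J T u v = (1 / 2 : ℝ) • (T (J u) (J v) - T u v) := by
  simp [chernTorsion]

/-- The Lee vector. -/
def leeVector (J : V →ₗ[ℝ] V) (T : V →ₗ[ℝ] V →ₗ[ℝ] V) {n : ℕ} (e : Fin n → V) : V :=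
  ∑ i, T (e i) (J (e i))

variable {T : V →ₗ[ℝ] V →ₗ[ℝ] V}

/-- A tensor with the symmetries of a difference of two Chern connections vanishes. -/
lemma HermitianPair.difference_eq_zero (h : HermitianPair g J) {B : V →ₗ[ℝ] V →ₗ[ℝ] V}
    (hskew : ∀ u v w, g (B u v) w = -g v (B u w)) (hJ : ∀ u v, B u (J v) = J (B u v))
    (ht : ∀ u v, B (J u) v - B v (J u) = B u (J v) - B (J v) u) (u v : V) : B u v = 0 := by
  -- The torsion condition, used for `(u, v)` and `(Ju, v)`, forces `B` to be complex linear in its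
  -- first argument as well.
  have hC : ∀ u v, B (J u) v - J (B u v) = 0 := by
    intro u v
    have h1 := ht u v
    have h2 := ht (J u) v
    have h3 := congrArg J (ht u v)
    simp only [hJ, h.sq, map_neg, map_sub, LinearMap.neg_apply] at h1 h2 h3
    have key : (2 : ℝ) • J (B (J u) v - J (B u v)) = 0 := by
      simp only [map_sub, h.sq]
      linear_combination (norm := module) (1 : ℝ) • h3 - (1 : ℝ) • h2
    exact h.J_eq_zero (by simpa using key)
  -- Now `B (J u) = J ∘ B u` is skew, whereas a skew endomorphism `B u` that commutes with `J` has a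
  -- symmetric product with `J`; so the product is zero.
  refine h.J_eq_zero (h.eq_zero_of_inner fun w ↦ ?_)
  have e1 : B (J u) v = J (B u v) := sub_eq_zero.1 (hC u v)
  have e2 : B (J u) w = J (B u w) := sub_eq_zero.1 (hC u w)
  have h1 := hskew (J u) v w
  rw [e1, e2] at h1
  have h2 := h.inner_J_left (B u v) w
  have h3 := hskew u v (J w)
  rw [hJ] at h3
  linarith

end LinearAlgebra

section LinearAlgebra

variable {V : Type*} [AddCommGroup V] [Module ℝ V]
  {g : V →ₗ[ℝ] V →ₗ[ℝ] ℝ} {J : V →ₗ[ℝ] V} {T : V →ₗ[ℝ] V →ₗ[ℝ] V}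

namespace BismutTorsion

variable (h : HermitianPair g J) (ht : BismutTorsion g J T)

include ht in
lemma self (u : V) : T u u = 0 := by
  have h1 : (2 : ℝ) • T u u = 0 := by
    rw [two_smul]; nth_rewrite 1 [ht.antisymm u u]; exact neg_add_cancel _
  exact (smul_eq_zero.1 h1).resolve_left two_ne_zero

include ht in
lemma inner_cyclic (u v w : V) : g (T u v) w = g (T v w) u := by
  rw [ht.antisymm u v, map_neg, LinearMap.neg_apply, ht.skew v u w, neg_neg]

include h ht

omit h in
lemma J_add (u v : V) : J (T (J u) v) + J (T u (J v)) = T (J u) (J v) - T u v := by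
  have := ht.nijenhuis u v
  linear_combination (norm := module) this

omit ht in
lemma chernDifference_inner (u v w : V) :
    g (chernDifference J T u v) w = -(1 / 2) * (g (T u v) w + g (T u (J v)) (J w)) := by
  simp only [chernDifference, map_smul, map_sub, LinearMap.smul_apply, LinearMap.sub_apply,
    smul_eq_mul, h.inner_J_left]
  ring

/-- `chernDifference J T u` is minus the `J`-linear part of the skew endomorphism `T u`, and taking
this part preserves skewness because `J` is orthogonal. Adding it to a metric connection therefore
keeps `g` parallel. -/
lemma chernDifference_skew (u v w : V) :
    g (chernDifference J T u v) w = -g v (chernDifference J T u w) := by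
  rw [h.symm v, chernDifference_inner h, chernDifference_inner h, ht.skew u v w,
    ht.skew u (J v) (J w)]
  ring

omit ht in
lemma chernDifference_J (u v : V) :
    chernDifference J T u (J v) = J (chernDifference J T u v) := by
  simp only [chernDifference, h.sq, map_smul, map_sub, map_neg]
  module

/-- A change of connection alters the torsion by the antisymmetrised difference tensor;
integrability removes the remaining mixed terms. -/
lemma chernDifference_torsion (u v : V) :
    T u v + chernDifference J T u v - chernDifference J T v u = chernTorsion J T u v := by
  rw [chernTorsion_apply, ← J_add ht]
  simp only [chernDifference]
  rw [ht.antisymm v u, ht.antisymm v (J u), map_neg]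
  module

/-- Integrability of `J` is what makes the Chern torsion complex bilinear, that is, free of a
`(1,1)`-part. -/
lemma chernTorsion_J_left (u v : V) : chernTorsion J T (J u) v = J (chernTorsion J T u v) := by
  have h1 := congrArg J (J_add ht u v)
  simp only [map_add, h.sq] at h1
  simp only [chernTorsion_apply, h.sq, map_smul, ← h1, map_neg, LinearMap.neg_apply]
  module

omit h in
lemma chernTorsion_antisymm (u v : V) : chernTorsion J T u v = -chernTorsion J T v u := by
  rw [chernTorsion_apply, chernTorsion_apply, ht.antisymm u v, ht.antisymm (J u) (J v)]
  module

lemma chernTorsion_J_right (u v : V) : chernTorsion J T u (J v) = J (chernTorsion J T u v) := by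
  rw [chernTorsion_antisymm ht, chernTorsion_J_left h ht, chernTorsion_antisymm ht u v, map_neg]

/-- This frame-free description of the Lee vector lets it be studied through traces of commutators.
-/
lemma trace_chernTorsion [FiniteDimensional ℝ V] {n : ℕ} (hn : Module.finrank ℝ V = 2 * n)
    {e : Fin n → V} (he : UnitaryFamily g J e) (u : V) :
    LinearMap.trace ℝ V (chernTorsion J T u) = g (J (leeVector J T e)) u := by
  rw [h.trace_eq_sum hn he, h.inner_J_left, leeVector, map_sum, LinearMap.sum_apply,
    ← Finset.sum_neg_distrib]
  refine Finset.sum_congr rfl fun i _ ↦ ?_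
  simp only [chernTorsion_apply, h.sq, map_smul, map_sub, map_neg, LinearMap.smul_apply,
    LinearMap.sub_apply, LinearMap.neg_apply, smul_eq_mul]
  have h1 : ∀ a b, g (T a b) b = 0 := fun a b ↦ by linarith [ht.skew a b b]
  have h2 := ht.skew (J u) (J (e i)) (e i)
  have h3 := ht.inner_cyclic (J u) (e i) (J (e i))
  rw [h1, h1]
  linarith

end BismutTorsion

/-! ### Algebra of the curvature when the torsion is parallel. -/

/-- The algebraic properties of the curvature of a Bismut connection with parallel torsion. -/
structure BismutCurvature (g : V →ₗ[ℝ] V →ₗ[ℝ] ℝ) (J : V →ₗ[ℝ] V) (T : V →ₗ[ℝ] V →ₗ[ℝ] V)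
    (R : V → V → V →ₗ[ℝ] V) : Prop where
  antisymm : ∀ u v w, R u v w = -R v u w
  skew : ∀ u v w z, g (R u v w) z = -g w (R u v z)
  commute : ∀ u v w, R u v (J w) = J (R u v w)
  derivation : ∀ u v a b, R u v (T a b) = T (R u v a) b + T a (R u v b)
  bianchi : ∀ u v w, R u v w + R v w u + R w u v = T (T u v) w + T (T v w) u + T (T w u) v

namespace BismutCurvature

variable {R : V → V → V →ₗ[ℝ] V} (h : HermitianPair g J) (ht : BismutTorsion g J T)
  (hR : BismutCurvature g J T R)
include h ht hR

lemma inner_bianchi (u v w z : V) :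
    g (R u v w) z + g (R v w u) z + g (R w u v) z
      = g (T u v) (T w z) + g (T v w) (T u z) + g (T w u) (T v z) := by
  have h1 := congrArg (fun y ↦ g y z) (hR.bianchi u v w)
  simp only [map_add, LinearMap.add_apply] at h1
  rw [h1, ht.inner_cyclic (T u v), ht.inner_cyclic (T v w), ht.inner_cyclic (T w u),
    h.symm (T w z), h.symm (T u z), h.symm (T v z)]

/-- The torsion side of `inner_bianchi` is totally skew in its four arguments, so it cancels in the
sum of four Bianchi identities that proves pair symmetry in Riemannian geometry. -/
lemma pair_symm (u v w z : V) : g (R u v w) z = g (R w z u) v := by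
  have a1 : ∀ u v w z, g (R u v w) z = -g (R v u w) z := fun u v w z ↦ by
    rw [hR.antisymm]; simp
  have a2 : ∀ u v w z, g (R u v w) z = -g (R u v z) w := fun u v w z ↦ by
    rw [hR.skew, h.symm]
  have s1 := inner_bianchi h ht hR v w u z
  have s2 := inner_bianchi h ht hR w u z v
  have s3 := inner_bianchi h ht hR u z v w
  have s4 := inner_bianchi h ht hR z v w u
  simp only [ht.antisymm z w, ht.antisymm v u, ht.antisymm z u, ht.antisymm w v,
    ht.antisymm u w, ht.antisymm z v, h.symm (T w z) (T u v), h.symm (T u z) (T v w),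
    h.symm (T v z) (T w u), map_neg, LinearMap.neg_apply] at s1 s2 s3 s4
  linarith [a2 w u v z, a2 v w u z, a2 u z w v, a2 z v w u, a1 u v z w, a2 u v w z, a2 w z u v,
    a1 z w u v]

/-- Pair symmetry transfers the commutation of `R` with `J` from the last two arguments to the first
two. -/
lemma pair_J (u v w : V) : R (J u) v w = -R u (J v) w := by
  refine h.eq_of_inner fun z ↦ ?_
  rw [map_neg, LinearMap.neg_apply, pair_symm h ht hR, pair_symm h ht hR u (J v), hR.commute,
    h.inner_J_left]

lemma J_pair_J (u v w : V) : R (J u) (J v) w = R u v w := by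
  refine h.eq_of_inner fun z ↦ ?_
  rw [pair_symm h ht hR, pair_symm h ht hR u v, hR.commute, h.inner_J]

/-- The Chern torsion satisfies the Jacobi identity. -/
lemma chernTorsion_jacobi (u v w : V) :
    chernTorsion J T (chernTorsion J T u v) w + chernTorsion J T (chernTorsion J T v w) u
      + chernTorsion J T (chernTorsion J T w u) v = 0 := by
  have key : ∀ u v w, (4 : ℝ) • chernTorsion J T (chernTorsion J T u v) w
      = T (T u v) w - T (T (J u) (J v)) w - T (T (J u) v) (J w) - T (T u (J v)) (J w) := by
    intro u v w
    have h1 := congrArg J (BismutTorsion.J_add ht u v)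
    simp only [map_add, h.sq] at h1
    have h2 : J (T (J u) (J v)) - J (T u v) = -T (J u) v - T u (J v) := by
      rw [← map_sub, ← h1]; abel
    rw [chernTorsion_apply J T (chernTorsion J T u v), chernTorsion_apply J T u v, map_smul,
      map_sub, h2]
    simp only [map_smul, map_sub, map_neg, LinearMap.smul_apply, LinearMap.sub_apply,
      LinearMap.neg_apply]
    module
  -- The combination `b2 + b3 + b4 - b1` has no curvature left, since `R` is `J`-invariant in its
  -- first pair; its torsion side is four times the Jacobi sum.
  have b1 := hR.bianchi u v w
  have b2 := hR.bianchi (J u) (J v) w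
  have b3 := hR.bianchi (J u) v (J w)
  have b4 := hR.bianchi u (J v) (J w)
  simp only [J_pair_J h ht hR, pair_J h ht hR, hR.commute] at b1 b2 b3 b4
  have : (4 : ℝ) • (chernTorsion J T (chernTorsion J T u v) w
      + chernTorsion J T (chernTorsion J T v w) u
      + chernTorsion J T (chernTorsion J T w u) v) = 0 := by
    rw [smul_add, smul_add, key, key, key]
    linear_combination (norm := module) b2 + b3 + b4 - b1
  exact (smul_eq_zero.1 this).resolve_left (by norm_num)

variable [FiniteDimensional ℝ V] {n : ℕ} (hn : Module.finrank ℝ V = 2 * n) {e : Fin n → V}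
  (he : UnitaryFamily g J e)
include hn he

/-- As `R u v` is a derivation of the Chern torsion, `chernTorsion J T (R u v w)` is the commutator
of `R u v` with `chernTorsion J T w`. Its trace `g(Jξ, R u v w)` is zero, and skewness moves `R u v`
onto `Jξ`. -/
lemma apply_leeVector (u v : V) : R u v (leeVector J T e) = 0 := by
  refine h.J_eq_zero (h.eq_zero_of_inner fun w ↦ ?_)
  have hc : chernTorsion J T (R u v w)
      = (R u v) * chernTorsion J T w - chernTorsion J T w * (R u v) := by
    ext z
    simp only [LinearMap.sub_apply, Module.End.mul_apply, chernTorsion_apply, map_smul, map_sub,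
      hR.derivation, hR.commute]
    module
  have h1 := BismutTorsion.trace_chernTorsion h ht hn he (R u v w)
  rw [hc, map_sub, LinearMap.trace_mul_comm, sub_self] at h1
  rw [← hR.commute, hR.skew, ← h1, neg_zero]

/-- By the Jacobi identity the operators `chernTorsion J T u` form an adjoint representation, so the
operator of a bracket is a commutator and has trace zero. -/
lemma inner_J_leeVector_chernTorsion (u v : V) :
    g (J (leeVector J T e)) (chernTorsion J T u v) = 0 := by
  rw [← BismutTorsion.trace_chernTorsion h ht hn he]
  have hc : chernTorsion J T (chernTorsion J T u v)
      = chernTorsion J T u * chernTorsion J T v - chernTorsion J T v * chernTorsion J T u := by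
    ext w
    have h1 := chernTorsion_jacobi h ht hR u v w
    rw [BismutTorsion.chernTorsion_antisymm ht (chernTorsion J T v w) u,
      BismutTorsion.chernTorsion_antisymm ht (chernTorsion J T w u) v,
      BismutTorsion.chernTorsion_antisymm ht w u, map_neg] at h1
    simp only [LinearMap.sub_apply, Module.End.mul_apply]
    linear_combination (norm := module) h1
  rw [hc, map_sub, LinearMap.trace_mul_comm, sub_self]

lemma inner_leeVector_chernTorsion (u v : V) :
    g (leeVector J T e) (chernTorsion J T u v) = 0 := by
  have h1 := inner_J_leeVector_chernTorsion h ht hR hn he (J u) v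
  rwa [BismutTorsion.chernTorsion_J_left h ht, h.inner_J] at h1

/-- Orthogonality of `ξ` to the bracket of `Jξ` and `w` involves `T(ξ, Jw)` and `T(Jξ, w)`. Total
skewness kills the first against `ξ` and turns the second into the claim. -/
lemma torsion_leeVector_J (w : V) : g (T (leeVector J T e) (J (leeVector J T e))) w = 0 := by
  set ξ := leeVector J T e with hξ
  have h1 := inner_leeVector_chernTorsion h ht hR hn he (J ξ) w
  rw [← hξ, chernTorsion_apply, h.sq] at h1
  simp only [map_smul, map_sub, map_neg, LinearMap.neg_apply, smul_eq_mul] at h1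
  have h2 := ht.inner_cyclic ξ (J ξ) w
  have h3 := ht.inner_cyclic ξ ξ (J w)
  rw [ht.self, map_zero, LinearMap.zero_apply] at h3
  rw [h.symm ξ (T ξ (J w)), h.symm ξ (T (J ξ) w)] at h1
  linarith

lemma torsion_leeVector : T (leeVector J T e) (J (leeVector J T e)) = 0 :=
  h.eq_zero_of_inner (torsion_leeVector_J h ht hR hn he)

/-- In the direction of the Lee vector, the holomorphic sectional curvature and the first Ricci
curvature of the Chern connection vanish. -/
theorem chern_leeVector {Rc : V → V → V → V} (hRc : ∀ u v w, Rc u v w = R u v w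
      + chernDifference J T (T u v) w
      + (chernDifference J T u (chernDifference J T v w)
        - chernDifference J T v (chernDifference J T u w))) (r : ℝ) {u : V}
    (hu : u = r • leeVector J T e) :
    g (Rc u (J u) (J u)) u = 0 ∧ ∑ i, g (Rc u (J u) (J (e i))) (e i) = 0 := by
  have hT : T u (J u) = 0 := by simp [hu, torsion_leeVector h ht hR hn he]
  -- Pair symmetry moves `ξ` from the last argument of `R`, where it is annihilated, to the first.
  have hR0 : ∀ v w, R u v w = 0 := fun v w ↦ h.eq_zero_of_inner fun z ↦ by
    rw [pair_symm h ht hR, hu, map_smul, apply_leeVector h ht hR hn he, smul_zero, map_zero,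
      LinearMap.zero_apply]
  have hA1 : chernDifference J T u u = 0 := by simp [chernDifference, hT, ht.self]
  have hA2 : chernDifference J T (J u) u = 0 := by
    rw [chernDifference, ht.antisymm, hT, ht.self]; simp
  have hAz : ∀ w, chernDifference J T w 0 = 0 := fun w ↦ by simp [chernDifference]
  have hz : ∀ w, chernDifference J T 0 w = 0 := fun w ↦ by simp [chernDifference]
  -- Only the commutator survives; by `hA1` and `hA2` both of its factors kill `u`.
  have hc : ∀ w, Rc u (J u) w = chernDifference J T u (chernDifference J T (J u) w)
      - chernDifference J T (J u) (chernDifference J T u w) := fun w ↦ by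
    rw [hRc, hT, hR0, hz, zero_add, zero_add]
  constructor
  · simp [hc, BismutTorsion.chernDifference_J h, hA1, hA2, hAz]
  · let A : V → V →ₗ[ℝ] V := fun a ↦ (-(1 / 2) : ℝ) • (T a - J ∘ₗ T a ∘ₗ J)
    have hA : ∀ a b, chernDifference J T a b = A a b := fun a b ↦ rfl
    have hAJ : ∀ a, A a * J = J * A a := fun a ↦
      LinearMap.ext fun b ↦ BismutTorsion.chernDifference_J h a b
    -- The commutator composed with `J` is real-traceless because `A (J u)` commutes with `J`. Each
    -- pair `e_i, Je_i` contributes twice the `i`-th Ricci term to this trace.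
    have h1 := h.trace_eq_sum hn he ((A u * A (J u) - A (J u) * A u) * J)
    have h2 : LinearMap.trace ℝ V ((A u * A (J u) - A (J u) * A u) * J) = 0 := by
      rw [sub_mul, map_sub, mul_assoc, LinearMap.trace_mul_comm, mul_assoc, mul_assoc, ← hAJ,
        sub_self]
    rw [h2] at h1
    have h3 : ∀ i, g ((((A u * A (J u) - A (J u) * A u) * J)) (e i)) (e i)
          + g ((((A u * A (J u) - A (J u) * A u) * J)) (J (e i))) (J (e i))
        = 2 * g (Rc u (J u) (J (e i))) (e i) := by
      intro i
      have e1 : ((A u * A (J u) - A (J u) * A u) * J) (e i) = Rc u (J u) (J (e i)) := by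
        rw [hc]; rfl
      have e2 : ((A u * A (J u) - A (J u) * A u) * J) (J (e i)) = J (Rc u (J u) (J (e i))) := by
        rw [hc]
        change chernDifference J T u (chernDifference J T (J u) (J (J (e i))))
          - chernDifference J T (J u) (chernDifference J T u (J (J (e i)))) = _
        simp only [BismutTorsion.chernDifference_J h, map_sub]
      rw [e1, e2, h.inner_J]; ring
    simp only [h3, ← Finset.mul_sum] at h1
    linarith

end BismutCurvature

end LinearAlgebra

/-! ### Vector fields near a point and the constant-coefficient extensions in a chart. -/

section Fields

variable {E : Type*} [NormedAddCommGroup E] [NormedSpace ℝ E]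
  {M : Type*} [TopologicalSpace M] [ChartedSpace E M] [IsManifold 𝓘(ℝ, E) ∞ M]

lemma isManifold_minSmoothness : IsManifold 𝓘(ℝ, E) (minSmoothness ℝ 2) M := by
  rw [minSmoothness_of_isRCLikeNormedField]
  infer_instance

/-- The vector field `X` is smooth on a neighbourhood of `x`. -/
def SmoothNear (X : Π x : M, TangentSpace 𝓘(ℝ, E) x) (x : M) : Prop :=
  ∀ᶠ z in 𝓝 x, ContMDiffAt 𝓘(ℝ, E) (𝓘(ℝ, E).prod 𝓘(ℝ, E)) ∞
    (fun y ↦ (⟨y, X y⟩ : TotalSpace E (fun y : M ↦ TangentSpace 𝓘(ℝ, E) y))) z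

/-- The function `f` is smooth on a neighbourhood of `x`. -/
def SmoothFunNear (f : M → ℝ) (x : M) : Prop :=
  ∀ᶠ z in 𝓝 x, ContMDiffAt 𝓘(ℝ, E) 𝓘(ℝ, ℝ) ∞ f z

variable {X Y : Π x : M, TangentSpace 𝓘(ℝ, E) x} {f : M → ℝ} {x : M}

namespace SmoothNear

lemma eventually (hX : SmoothNear X x) : ∀ᶠ z in 𝓝 x, SmoothNear X z :=
  Eventually.eventually_nhds hX

lemma diffAt (hX : SmoothNear X x) : DiffAt X x :=
  (Eventually.self_of_nhds hX).mdifferentiableAt (by simp)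

lemma congr (hX : SmoothNear X x) (h : ∀ᶠ z in 𝓝 x, Y z = X z) : SmoothNear Y x := by
  filter_upwards [hX, h.eventually_nhds] with z hz hz'
  exact hz.congr_of_eventuallyEq (hz'.mono fun y hy ↦ by simp [hy])

lemma add (hX : SmoothNear X x) (hY : SmoothNear Y x) : SmoothNear (X + Y) x := by
  filter_upwards [hX, hY] with z hz hz'
  exact hz.add_section hz'

lemma sub (hX : SmoothNear X x) (hY : SmoothNear Y x) : SmoothNear (X - Y) x := by
  filter_upwards [hX, hY] with z hz hz'
  exact hz.sub_section hz'

lemma smul (hf : SmoothFunNear (E := E) f x) (hX : SmoothNear X x) : SmoothNear (f • X) x := by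
  filter_upwards [hX, hf] with z hz hz'
  exact hz'.smul_section hz

lemma const_smul (a : ℝ) (hX : SmoothNear X x) : SmoothNear (a • X) x := by
  filter_upwards [hX] with z hz
  exact hz.const_smul_section

lemma sum {ι : Type*} {s : Finset ι} {t : ι → Π x : M, TangentSpace 𝓘(ℝ, E) x}
    (ht : ∀ i ∈ s, SmoothNear (t i) x) : SmoothNear (fun y ↦ ∑ i ∈ s, t i y) x := by
  have h1 := (Filter.eventually_all_finset s).2 ht
  filter_upwards [h1] with z hz
  exact ContMDiffAt.sum_section hz

lemma mlieBracket [FiniteDimensional ℝ E] (hX : SmoothNear X x) (hY : SmoothNear Y x) :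
    SmoothNear (VectorField.mlieBracket 𝓘(ℝ, E) X Y) x := by
  filter_upwards [hX, hY] with z hz hz'
  have : IsManifold 𝓘(ℝ, E) (minSmoothness ℝ 2) M := isManifold_minSmoothness
  have : IsManifold 𝓘(ℝ, E) (((⊤ : ℕ∞) : WithTop ℕ∞) + 1) M := by
    simpa using! (inferInstance : IsManifold 𝓘(ℝ, E) ∞ M)
  exact ContMDiffAt.mlieBracket_vectorField (n := ⊤) (m := ⊤) hz hz' (by simp)

lemma J (S : ComplexStructure E M) (hX : SmoothNear X x) :
    SmoothNear (fun y ↦ S.J y (X y)) x := by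
  filter_upwards [hX] with z hz
  exact ContMDiffAt.clm_bundle_apply (S.smooth z) hz

lemma inner (g : Metric E M) (hX : SmoothNear X x) (hY : SmoothNear Y x) :
    SmoothFunNear (E := E) (fun y ↦ g.inner y (X y) (Y y)) x := by
  filter_upwards [hX, hY] with z hz hz'
  have h1 := ContMDiffAt.clm_bundle_apply₂ (g.contMDiff z) hz hz'
    (E₃ := Bundle.Trivial M ℝ) (F₃ := ℝ)
  exact (Bundle.contMDiffAt_totalSpace.1 h1).2

end SmoothNear

lemma smoothNear_extend (u : TangentSpace 𝓘(ℝ, E) x) : SmoothNear (FiberBundle.extend E u) x := by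
  obtain ⟨s, hs, h⟩ := FiberBundle.exists_contMDiffOn_extend (k := ∞) 𝓘(ℝ, E) E u
  filter_upwards [eventually_mem_nhds_iff.2 hs] with z hz
  exact h.contMDiffAt hz

variable (E x) in
/-- The coefficients, in the chart at `x`, of the constant extension of a tangent vector at `x`. -/
def chartCoeff : TangentSpace 𝓘(ℝ, E) x →L[ℝ] E :=
  (trivializationAt E (fun y : M ↦ TangentSpace 𝓘(ℝ, E) y) x).continuousLinearMapAt ℝ x

lemma extend_eq_mfderivWithin (u : TangentSpace 𝓘(ℝ, E) x) {y : M}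
    (hy : y ∈ (extChartAt 𝓘(ℝ, E) x).source) :
    FiberBundle.extend E u y = mfderivWithin 𝓘(ℝ, E) 𝓘(ℝ, E) (extChartAt 𝓘(ℝ, E) x).symm
      (Set.range 𝓘(ℝ, E)) (extChartAt 𝓘(ℝ, E) x y) (chartCoeff E x u) := by
  have hy' : y ∈ (chartAt E x).source := by simpa using hy
  rw [← TangentBundle.symmL_trivializationAt (I := 𝓘(ℝ, E)) hy']
  have h1 : chartCoeff E x u
      = (trivializationAt E (fun y : M ↦ TangentSpace 𝓘(ℝ, E) y) x ⟨x, u⟩).2 := by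
    rw [chartCoeff, Trivialization.continuousLinearMapAt_apply,
      Trivialization.coe_linearMapAt_of_mem]
    exact FiberBundle.mem_baseSet_trivializationAt' x
  rw [h1]
  exact (Trivialization.symmL_apply _ (by simpa using hy') _).symm

/-- Viewing the extensions as pullbacks of constant fields makes their Lie brackets vanish by
naturality. -/
lemma extend_eq_mpullback (u : TangentSpace 𝓘(ℝ, E) x) {y : M}
    (hy : y ∈ (extChartAt 𝓘(ℝ, E) x).source) :
    FiberBundle.extend E u y = VectorField.mpullback 𝓘(ℝ, E) 𝓘(ℝ, E) (extChartAt 𝓘(ℝ, E) x)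
      (fun _ ↦ chartCoeff E x u) y := by
  have hi := ContinuousLinearMap.inverse_eq
    (mfderiv_extChartAt_comp_mfderivWithin_extChartAt_symm' (I := 𝓘(ℝ, E)) hy)
    (mfderivWithin_extChartAt_symm_comp_mfderiv_extChartAt' hy)
  exact (extend_eq_mfderivWithin u hy).trans (DFunLike.congr_fun hi (chartCoeff E x u)).symm

lemma eventually_extend_add (u v : TangentSpace 𝓘(ℝ, E) x) :
    ∀ᶠ y in 𝓝 x, FiberBundle.extend E (u + v) y
      = FiberBundle.extend E u y + FiberBundle.extend E v y := by
  filter_upwards [extChartAt_source_mem_nhds (I := 𝓘(ℝ, E)) x] with y hy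
  rw [extend_eq_mfderivWithin _ hy, extend_eq_mfderivWithin _ hy, extend_eq_mfderivWithin _ hy,
    map_add]
  exact map_add _ _ _

lemma eventually_extend_smul (a : ℝ) (u : TangentSpace 𝓘(ℝ, E) x) :
    ∀ᶠ y in 𝓝 x, FiberBundle.extend E (a • u) y = a • FiberBundle.extend E u y := by
  filter_upwards [extChartAt_source_mem_nhds (I := 𝓘(ℝ, E)) x] with y hy
  rw [extend_eq_mfderivWithin _ hy, extend_eq_mfderivWithin _ hy, map_smul]
  exact map_smul _ _ _

lemma eventually_mlieBracket_extend [FiniteDimensional ℝ E] (u v : TangentSpace 𝓘(ℝ, E) x) :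
    ∀ᶠ y in 𝓝 x, VectorField.mlieBracket 𝓘(ℝ, E) (FiberBundle.extend E u)
      (FiberBundle.extend E v) y = 0 := by
  have : IsManifold 𝓘(ℝ, E) (minSmoothness ℝ 2) M := isManifold_minSmoothness
  filter_upwards [eventually_eventually_nhds.2 (extChartAt_source_mem_nhds (I := 𝓘(ℝ, E)) x)]
    with y hy
  have hy' : y ∈ (extChartAt 𝓘(ℝ, E) x).source := hy.self_of_nhds
  have hc : ∀ w : E, MDifferentiableAt 𝓘(ℝ, E) (𝓘(ℝ, E).prod 𝓘(ℝ, E))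
      (fun y ↦ (⟨y, w⟩ : TotalSpace E (fun y : E ↦ TangentSpace 𝓘(ℝ, E) y)))
      (extChartAt 𝓘(ℝ, E) x y) := fun w ↦ by
    refine ContMDiffAt.mdifferentiableAt (n := 1) ?_ one_ne_zero
    exact contMDiffAt_vectorSpace_iff_contDiffAt.2 contDiffAt_const
  have h1 := VectorField.mpullback_mlieBracket (hc (chartCoeff E x u)) (hc (chartCoeff E x v))
    (contMDiffAt_extChartAt' (n := ∞) (I := 𝓘(ℝ, E)) (by simpa using hy'))
    (by rw [minSmoothness_of_isRCLikeNormedField]; exact ENat.LEInfty.out)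
  have h2 : VectorField.mlieBracket 𝓘(ℝ, E) (FiberBundle.extend E u) (FiberBundle.extend E v) y
      = _ := Filter.EventuallyEq.mlieBracket_vectorField_eq
    (hy.mono fun z hz ↦ extend_eq_mpullback u hz) (hy.mono fun z hz ↦ extend_eq_mpullback v hz)
  have h3 : VectorField.mlieBracket 𝓘(ℝ, E) (fun _ : E ↦ chartCoeff E x u)
      (fun _ : E ↦ chartCoeff E x v) (extChartAt 𝓘(ℝ, E) x y) = 0 := by
    have h4 : ∀ a b z : E, VectorField.lieBracketWithin ℝ (fun _ ↦ a) (fun _ ↦ b) Set.univ z = 0 :=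
      fun a b z ↦ by simp [VectorField.lieBracketWithin]
    exact (congrFun (VectorField.mlieBracketWithin_eq_lieBracketWithin (s := Set.univ)) _).trans
      (h4 _ _ _)
  rw [h2, ← h1, VectorField.mpullback_apply, h3, map_zero]

lemma mvfderiv_extend (u : TangentSpace 𝓘(ℝ, E) x) {y : M}
    (hf : MDifferentiableAt 𝓘(ℝ, E) 𝓘(ℝ, ℝ) f y) (hy : y ∈ (extChartAt 𝓘(ℝ, E) x).source) :
    mvfderiv 𝓘(ℝ, E) f y (FiberBundle.extend E u y)
      = fderiv ℝ (f ∘ (extChartAt 𝓘(ℝ, E) x).symm) (extChartAt 𝓘(ℝ, E) x y)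
        (chartCoeff E x u) := by
  have hsymm : MDifferentiableAt 𝓘(ℝ, E) 𝓘(ℝ, E) (extChartAt 𝓘(ℝ, E) x).symm
      (extChartAt 𝓘(ℝ, E) x y) := by
    have := mdifferentiableWithinAt_extChartAt_symm ((extChartAt 𝓘(ℝ, E) x).map_source hy)
    rwa [show Set.range 𝓘(ℝ, E) = Set.univ by simp, mdifferentiableWithinAt_univ] at this
  have hl := (extChartAt 𝓘(ℝ, E) x).left_inv hy
  have h1 := mvfderiv_comp_apply_of_eq _ hf hsymm hl (chartCoeff E x u)
  have h2 := extend_eq_mfderivWithin u hy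
  rw [show Set.range 𝓘(ℝ, E) = Set.univ by simp, mfderivWithin_univ] at h2
  refine (congrArg (mvfderiv 𝓘(ℝ, E) f y) h2).trans (h1.symm.trans ?_)
  rw [mvfderiv, mfderiv_eq_fderiv]
  rfl

lemma SmoothFunNear.contDiffAt_comp_symm (hf : SmoothFunNear (E := E) f x) :
    ∀ᶠ y in 𝓝 x, ContDiffAt ℝ ∞ (f ∘ (extChartAt 𝓘(ℝ, E) x).symm) (extChartAt 𝓘(ℝ, E) x y) := by
  filter_upwards [hf, extChartAt_source_mem_nhds (I := 𝓘(ℝ, E)) x] with y hy hys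
  have h1 : ContMDiffAt 𝓘(ℝ, E) 𝓘(ℝ, E) ∞ (extChartAt 𝓘(ℝ, E) x).symm
      (extChartAt 𝓘(ℝ, E) x y) :=
    (contMDiffOn_extChartAt_symm x).contMDiffAt
      ((isOpen_extChartAt_target x).mem_nhds ((extChartAt 𝓘(ℝ, E) x).map_source hys))
  rw [← contMDiffAt_iff_contDiffAt]
  refine ContMDiffAt.comp _ ?_ h1
  rwa [(extChartAt 𝓘(ℝ, E) x).left_inv hys]

omit [IsManifold 𝓘(ℝ, E) ∞ M] in
lemma SmoothFunNear.mdifferentiableAt (hf : SmoothFunNear (E := E) f x) :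
    MDifferentiableAt 𝓘(ℝ, E) 𝓘(ℝ, ℝ) f x :=
  (Eventually.self_of_nhds hf).mdifferentiableAt (by simp)

lemma SmoothFunNear.eventually_mvfderiv_extend (hf : SmoothFunNear (E := E) f x)
    (u : TangentSpace 𝓘(ℝ, E) x) :
    ∀ᶠ y in 𝓝 x, mvfderiv 𝓘(ℝ, E) f y (FiberBundle.extend E u y)
      = fderiv ℝ (f ∘ (extChartAt 𝓘(ℝ, E) x).symm) (extChartAt 𝓘(ℝ, E) x y)
        (chartCoeff E x u) := by
  filter_upwards [hf, extChartAt_source_mem_nhds (I := 𝓘(ℝ, E)) x] with y hy hys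
  exact mvfderiv_extend u (hy.mdifferentiableAt (by simp)) hys

lemma SmoothFunNear.mvfderiv_extend (hf : SmoothFunNear (E := E) f x)
    (u : TangentSpace 𝓘(ℝ, E) x) :
    SmoothFunNear (E := E) (fun y ↦ mvfderiv 𝓘(ℝ, E) f y (FiberBundle.extend E u y)) x := by
  filter_upwards [hf.contDiffAt_comp_symm, (hf.eventually_mvfderiv_extend u).eventually_nhds,
    extChartAt_source_mem_nhds (I := 𝓘(ℝ, E)) x] with y hy hye hys
  refine ContMDiffAt.congr_of_eventuallyEq ?_ hye
  have h1 : ContDiffAt ℝ ∞ (fun z ↦ fderiv ℝ (f ∘ (extChartAt 𝓘(ℝ, E) x).symm) z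
      (chartCoeff E x u)) (extChartAt 𝓘(ℝ, E) x y) :=
    (hy.fderiv_right (by simp)).clm_apply contDiffAt_const
  exact ContMDiffAt.comp (I' := 𝓘(ℝ, E)) _ h1.contMDiffAt
    (contMDiffAt_extChartAt' (by simpa using hys))

/-- Derivatives in the directions of two coordinate vector fields commute. -/
lemma SmoothFunNear.mvfderiv_mvfderiv_comm (hf : SmoothFunNear (E := E) f x)
    (u v : TangentSpace 𝓘(ℝ, E) x) :
    mvfderiv 𝓘(ℝ, E) (fun y ↦ mvfderiv 𝓘(ℝ, E) f y (FiberBundle.extend E v y)) x u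
      = mvfderiv 𝓘(ℝ, E) (fun y ↦ mvfderiv 𝓘(ℝ, E) f y (FiberBundle.extend E u y)) x v := by
  have key : ∀ u v : TangentSpace 𝓘(ℝ, E) x,
      mvfderiv 𝓘(ℝ, E) (fun y ↦ mvfderiv 𝓘(ℝ, E) f y (FiberBundle.extend E v y)) x u
      = fderiv ℝ (fderiv ℝ (f ∘ (extChartAt 𝓘(ℝ, E) x).symm)) (extChartAt 𝓘(ℝ, E) x x)
        (chartCoeff E x u) (chartCoeff E x v) := by
    intro u v
    have hx := mem_extChartAt_source (I := 𝓘(ℝ, E)) x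
    have h1 := HermitianGeometry.mvfderiv_extend u (hf.mvfderiv_extend v).mdifferentiableAt hx
    rw [FiberBundle.extend_apply_self] at h1
    rw [h1]
    have hc : ContinuousAt (extChartAt 𝓘(ℝ, E) x).symm (extChartAt 𝓘(ℝ, E) x x) :=
      continuousAt_extChartAt_symm x
    have ht : Tendsto (extChartAt 𝓘(ℝ, E) x).symm (𝓝 (extChartAt 𝓘(ℝ, E) x x)) (𝓝 x) := by
      have := hc.tendsto
      rwa [extChartAt_to_inv] at this
    have h2 : (fun y ↦ mvfderiv 𝓘(ℝ, E) f y (FiberBundle.extend E v y))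
        ∘ (extChartAt 𝓘(ℝ, E) x).symm =ᶠ[𝓝 (extChartAt 𝓘(ℝ, E) x x)]
        fun z ↦ fderiv ℝ (f ∘ (extChartAt 𝓘(ℝ, E) x).symm) z (chartCoeff E x v) := by
      filter_upwards [ht.eventually (hf.eventually_mvfderiv_extend v),
        extChartAt_target_mem_nhds (I := 𝓘(ℝ, E)) x] with z hz hzt
      rw [Function.comp_apply, hz, (extChartAt 𝓘(ℝ, E) x).right_inv hzt]
    rw [h2.fderiv_eq]
    have h3 : DifferentiableAt ℝ (fderiv ℝ (f ∘ (extChartAt 𝓘(ℝ, E) x).symm))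
        (extChartAt 𝓘(ℝ, E) x x) :=
      ((hf.contDiffAt_comp_symm.self_of_nhds).fderiv_right (m := 1)
        (by rw [one_add_one_eq_two]; exact ENat.LEInfty.out)).differentiableAt
        one_ne_zero
    rw [fderiv_clm_apply h3 (differentiableAt_const _)]
    simp
  rw [key, key]
  exact ((hf.contDiffAt_comp_symm.self_of_nhds).isSymmSndFDerivAt
    (by rw [minSmoothness_of_isRCLikeNormedField]; exact ENat.LEInfty.out)) _ _

end Fields

/-! ### Locality of connections and tensoriality of the curvature. -/

section Connections

variable {E : Type*} [NormedAddCommGroup E] [NormedSpace ℝ E]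
  {M : Type*} [TopologicalSpace M] [ChartedSpace E M] [IsManifold 𝓘(ℝ, E) ∞ M]
  {D : Connection E M} {X Y F G : Π x : M, TangentSpace 𝓘(ℝ, E) x} {f : M → ℝ} {x : M}

lemma DiffAt.congr (hX : DiffAt X x) (h : ∀ᶠ z in 𝓝 x, Y z = X z) : DiffAt Y x :=
  MDifferentiableAt.congr_of_eventuallyEq hX (h.mono fun y hy ↦ by simp [hy])

lemma conn_congr (hX : DiffAt X x) (h : ∀ᶠ z in 𝓝 x, Y z = X z) : D Y x = D X x :=
  D.isCovariantDerivativeOnUniv.congr_of_eventuallyEq (hX.congr h) hX univ_mem h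

lemma conn_add (hX : DiffAt X x) (hY : DiffAt Y x) : D (X + Y) x = D X x + D Y x :=
  D.isCovariantDerivativeOnUniv.add hX hY

lemma conn_smul (hf : MDifferentiableAt 𝓘(ℝ, E) 𝓘(ℝ, ℝ) f x) (hX : DiffAt X x)
    (u : TangentSpace 𝓘(ℝ, E) x) :
    D (f • X) x u = f x • D X x u + mvfderiv 𝓘(ℝ, E) f x u • X x := by
  rw [D.isCovariantDerivativeOnUniv.leibniz hX hf]
  rfl

lemma conn_const_smul (a : ℝ) (hX : DiffAt X x) : D (a • X) x = a • D X x :=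
  D.isCovariantDerivativeOnUniv.smul_const a hX

lemma DiffAt.const_smul (a : ℝ) (hX : DiffAt X x) : DiffAt (a • X) x :=
  MDifferentiableAt.smul_const_section hX

lemma conn_sub (hX : DiffAt X x) (hY : DiffAt Y x) : D (X - Y) x = D X x - D Y x := by
  have h1 : X - Y = X + (-1 : ℝ) • Y := by
    funext y; simp [sub_eq_add_neg]
  rw [h1, conn_add hX (hY.const_smul _), conn_const_smul _ hY]
  simp [sub_eq_add_neg]

variable [FiniteDimensional ℝ E]

/-- The covariant derivative of a smooth vector field along a smooth vector field is smooth. -/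
lemma SmoothNear.conn [T2Space M] (hD : D.ContMDiffCovariantDerivative ∞) (hF : SmoothNear F x)
    (hX : SmoothNear X x) : SmoothNear (fun y ↦ D F y (X y)) x := by
  -- Smoothness of `D` is available for globally smooth fields, so `F` is cut off by a bump function
  -- equal to `1` near `x`; locality of `D` then removes the cutoff.
  obtain ⟨s, hs, hso, hxs⟩ := eventually_nhds_iff.1 hF
  obtain ⟨χ, -, hχ⟩ := (SmoothBumpFunction.nhds_basis_tsupport (I := 𝓘(ℝ, E)) (c := x)).mem_iff.1
    (hso.mem_nhds hxs)
  have hsm : ContMDiffOn 𝓘(ℝ, E) (𝓘(ℝ, E).prod 𝓘(ℝ, E)) ∞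
      (fun y ↦ (⟨y, F y⟩ : TotalSpace E (fun y : M ↦ TangentSpace 𝓘(ℝ, E) y))) s :=
    fun y hy ↦ (hs y hy).contMDiffWithinAt
  have hG := ContMDiffOn.smul_section_of_tsupport χ.contMDiff.contMDiffOn hso hχ hsm
  have hDG := hD.contMDiff.contMDiff (σ := (χ : M → ℝ) • F) (by simpa using hG.contMDiffOn)
  have heq : ∀ᶠ z in 𝓝 x, ∀ᶠ y in 𝓝 z, F y = ((χ : M → ℝ) • F) y := by
    refine Eventually.eventually_nhds ?_
    filter_upwards [χ.eventuallyEq_one] with y hy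
    simp [hy]
  filter_upwards [hX, heq, heq.eventually_nhds] with z hz hzeq hzz
  refine (ContMDiffAt.clm_bundle_apply (hDG.contMDiffAt univ_mem) hz).congr_of_eventuallyEq ?_
  filter_upwards [hzz] with y hy
  rw [conn_congr (D := D) (hG.contMDiffAt.mdifferentiableAt (by simp)) hy]

omit [FiniteDimensional ℝ E] in
lemma SmoothNear.conn_eventually_congr (hF : SmoothNear F x) (h : ∀ᶠ z in 𝓝 x, G z = F z) :
    ∀ᶠ z in 𝓝 x, D G z = D F z := by
  filter_upwards [hF.eventually, h.eventually_nhds] with z hz hz'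
  exact conn_congr hz.diffAt hz'

lemma torsion_eq (hX : DiffAt X x) (hY : DiffAt Y x) :
    D.torsion x (X x) (Y x) = D Y x (X x) - D X x (Y x) - VectorField.mlieBracket 𝓘(ℝ, E) X Y x :=
  D.torsion_apply hX hY

lemma SmoothNear.torsion [T2Space M] (hD : D.ContMDiffCovariantDerivative ∞)
    (hX : SmoothNear X x) (hY : SmoothNear Y x) :
    SmoothNear (fun y ↦ D.torsion y (X y) (Y y)) x := by
  refine (((hY.conn hD hX).sub (hX.conn hD hY)).sub (hX.mlieBracket hY)).congr ?_
  filter_upwards [hX.eventually, hY.eventually] with z hz hz'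
  exact torsion_eq hz.diffAt hz'.diffAt

lemma torsion_extend (u v : TangentSpace 𝓘(ℝ, E) x) :
    D.torsion x u v = D (FiberBundle.extend E v) x u - D (FiberBundle.extend E u) x v := by
  have h1 := torsion_eq (D := D) (smoothNear_extend u).diffAt (smoothNear_extend v).diffAt
  rw [(eventually_mlieBracket_extend u v).self_of_nhds] at h1
  simpa using h1

lemma eventually_torsion_extend (u v : TangentSpace 𝓘(ℝ, E) x) :
    ∀ᶠ y in 𝓝 x, D.torsion y (FiberBundle.extend E u y) (FiberBundle.extend E v y)
      = D (FiberBundle.extend E v) y (FiberBundle.extend E u y)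
        - D (FiberBundle.extend E u) y (FiberBundle.extend E v y) := by
  filter_upwards [(smoothNear_extend u).eventually, (smoothNear_extend v).eventually,
    eventually_mlieBracket_extend u v] with y h1 h2 h3
  rw [torsion_eq h1.diffAt h2.diffAt, h3, sub_zero]

lemma curvatureField_extend (u v : TangentSpace 𝓘(ℝ, E) x) :
    curvatureField D (FiberBundle.extend E u) (FiberBundle.extend E v) F x
      = D (fun y ↦ D F y (FiberBundle.extend E v y)) x u
        - D (fun y ↦ D F y (FiberBundle.extend E u y)) x v := by
  rw [curvatureField, (eventually_mlieBracket_extend u v).self_of_nhds]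
  simp

section Smooth

variable [T2Space M] (hD : D.ContMDiffCovariantDerivative ∞)
include hD

lemma curvatureField_congr (u v : TangentSpace 𝓘(ℝ, E) x) (hF : SmoothNear F x)
    (h : ∀ᶠ z in 𝓝 x, G z = F z) :
    curvatureField D (FiberBundle.extend E u) (FiberBundle.extend E v) G x
      = curvatureField D (FiberBundle.extend E u) (FiberBundle.extend E v) F x := by
  have key : ∀ w : TangentSpace 𝓘(ℝ, E) x,
      D (fun y ↦ D G y (FiberBundle.extend E w y)) x
        = D (fun y ↦ D F y (FiberBundle.extend E w y)) x := fun w ↦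
    conn_congr (hF.conn hD (smoothNear_extend w)).diffAt
      ((hF.conn_eventually_congr (D := D) h).mono fun z hz ↦ by rw [hz])
  rw [curvatureField_extend, curvatureField_extend, key, key]

lemma curvatureField_add (u v : TangentSpace 𝓘(ℝ, E) x) (hF : SmoothNear F x)
    (hG : SmoothNear G x) :
    curvatureField D (FiberBundle.extend E u) (FiberBundle.extend E v) (F + G) x
      = curvatureField D (FiberBundle.extend E u) (FiberBundle.extend E v) F x
        + curvatureField D (FiberBundle.extend E u) (FiberBundle.extend E v) G x := by
  have key : ∀ w : TangentSpace 𝓘(ℝ, E) x,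
      D (fun y ↦ D (F + G) y (FiberBundle.extend E w y)) x
        = D (fun y ↦ D F y (FiberBundle.extend E w y)) x
          + D (fun y ↦ D G y (FiberBundle.extend E w y)) x := fun w ↦ by
    have h1 := hF.conn hD (smoothNear_extend w)
    have h2 := hG.conn hD (smoothNear_extend w)
    rw [← conn_add h1.diffAt h2.diffAt]
    refine conn_congr (h1.add h2).diffAt ?_
    filter_upwards [hF.eventually, hG.eventually] with z hz hz'
    rw [conn_add hz.diffAt hz'.diffAt]
    rfl
  rw [curvatureField_extend, curvatureField_extend, curvatureField_extend, key, key]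
  simp only [_root_.add_apply]
  abel

/-- After antisymmetrisation the first-derivative terms of `f` cancel in pairs, and the second
derivatives along coordinate fields commute. -/
lemma curvatureField_smul (u v : TangentSpace 𝓘(ℝ, E) x) (hf : SmoothFunNear (E := E) f x)
    (hF : SmoothNear F x) :
    curvatureField D (FiberBundle.extend E u) (FiberBundle.extend E v) (f • F) x
      = f x • curvatureField D (FiberBundle.extend E u) (FiberBundle.extend E v) F x := by
  have key : ∀ w z : TangentSpace 𝓘(ℝ, E) x,
      D (fun y ↦ D (f • F) y (FiberBundle.extend E w y)) x z
        = f x • D (fun y ↦ D F y (FiberBundle.extend E w y)) x z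
          + mvfderiv 𝓘(ℝ, E) f x z • D F x w
          + (mvfderiv 𝓘(ℝ, E) f x w • D F x z
            + mvfderiv 𝓘(ℝ, E) (fun y ↦ mvfderiv 𝓘(ℝ, E) f y (FiberBundle.extend E w y)) x z
              • F x) := fun w z ↦ by
    have h1 := hF.conn hD (smoothNear_extend w)
    have h2 := hf.mvfderiv_extend w
    have h3 : D (fun y ↦ D (f • F) y (FiberBundle.extend E w y)) x
        = D (f • (fun y ↦ D F y (FiberBundle.extend E w y))
          + (fun y ↦ mvfderiv 𝓘(ℝ, E) f y (FiberBundle.extend E w y)) • F) x := by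
      refine conn_congr ((SmoothNear.smul hf h1).add (SmoothNear.smul h2 hF)).diffAt ?_
      filter_upwards [hF.eventually, hf] with y hy hfy
      rw [conn_smul (hfy.mdifferentiableAt (by simp)) hy.diffAt]
      rfl
    rw [h3, conn_add (SmoothNear.smul hf h1).diffAt (SmoothNear.smul h2 hF).diffAt,
      _root_.add_apply, conn_smul hf.mdifferentiableAt h1.diffAt,
      conn_smul h2.mdifferentiableAt hF.diffAt]
    simp only [FiberBundle.extend_apply_self]
  rw [curvatureField_extend, curvatureField_extend, key, key, hf.mvfderiv_mvfderiv_comm u v]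
  module

lemma curvatureField_sum {ι : Type*} (s : Finset ι) {t : ι → Π x : M, TangentSpace 𝓘(ℝ, E) x}
    (u v : TangentSpace 𝓘(ℝ, E) x) (ht : ∀ i, SmoothNear (t i) x) :
    curvatureField D (FiberBundle.extend E u) (FiberBundle.extend E v) (fun y ↦ ∑ i ∈ s, t i y) x
      = ∑ i ∈ s, curvatureField D (FiberBundle.extend E u) (FiberBundle.extend E v) (t i) x := by
  classical
  induction s using Finset.induction_on with
  | empty =>
    have h0 : SmoothFunNear (E := E) (fun _ : M ↦ (0 : ℝ)) x :=
      Eventually.of_forall fun _ ↦ contMDiffAt_const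
    have h1 := curvatureField_smul hD u v h0 (smoothNear_extend u)
    have h2 : (fun _ : M ↦ (0 : ℝ)) • FiberBundle.extend E u
        = fun y ↦ ∑ i ∈ (∅ : Finset ι), t i y := by
      funext y; simp
    rw [h2, zero_smul] at h1
    rw [h1, Finset.sum_empty]
  | insert i s hi ih =>
    have h1 := curvatureField_add hD u v (ht i) (SmoothNear.sum (s := s) fun j _ ↦ ht j)
    have h2 : (t i + fun y ↦ ∑ j ∈ s, t j y) = fun y ↦ ∑ j ∈ insert i s, t j y := by
      funext y; simp [hi]
    rw [h2] at h1
    rw [h1, ih, Finset.sum_insert hi]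

/-- The curvature is tensorial in its last argument. -/
lemma curvatureField_eq (u v : TangentSpace 𝓘(ℝ, E) x) (hF : SmoothNear F x) :
    curvatureField D (FiberBundle.extend E u) (FiberBundle.extend E v) F x
      = curvature D x u v (F x) := by
  let t := trivializationAt E (fun y : M ↦ TangentSpace 𝓘(ℝ, E) y) x
  let b := Module.Basis.ofVectorSpace ℝ E
  have hxt : x ∈ t.baseSet := FiberBundle.mem_baseSet_trivializationAt' x
  have hfr : ∀ i, SmoothNear (t.localFrame b i) x := fun i ↦ by
    filter_upwards [t.open_baseSet.mem_nhds hxt] with z hz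
    exact contMDiffAt_localFrame_of_mem ∞ t b i hz
  have hco : ∀ {F : Π x : M, TangentSpace 𝓘(ℝ, E) x}, SmoothNear F x → ∀ i,
      SmoothFunNear (E := E) (fun y ↦ t.localFrameCoeff 𝓘(ℝ, E) b i y (F y)) x := fun hF i ↦ by
    filter_upwards [t.open_baseSet.mem_nhds hxt, hF] with z hz hFz
    exact contMDiffAt_localFrameCoeff b hz hFz i
  -- Expanding in a local frame shows that the curvature sees only the value of `F` at `x`.
  have key : ∀ {F : Π x : M, TangentSpace 𝓘(ℝ, E) x}, SmoothNear F x →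
      curvatureField D (FiberBundle.extend E u) (FiberBundle.extend E v) F x
        = ∑ i, t.localFrameCoeff 𝓘(ℝ, E) b i x (F x)
          • curvatureField D (FiberBundle.extend E u) (FiberBundle.extend E v)
            (t.localFrame b i) x := by
    intro F hF
    have h1 := fun i ↦ SmoothNear.smul (hco hF i) (hfr i)
    rw [curvatureField_congr hD u v (SmoothNear.sum (s := Finset.univ) fun i _ ↦ h1 i)
      (t.eventually_eq_localFrame_sum_coeff_smul b hxt), curvatureField_sum hD _ u v h1]
    exact Finset.sum_congr rfl fun i _ ↦ curvatureField_smul hD u v (hco hF i) (hfr i)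
  rw [key hF, curvature, key (smoothNear_extend (F x)), FiberBundle.extend_apply_self]

lemma curvature_add (u v w z : TangentSpace 𝓘(ℝ, E) x) :
    curvature D x u v (w + z) = curvature D x u v w + curvature D x u v z := by
  have h1 := smoothNear_extend w
  have h2 := smoothNear_extend z
  rw [curvature, curvatureField_congr hD u v (h1.add h2) (eventually_extend_add w z),
    curvatureField_add hD u v h1 h2]
  rfl

lemma curvature_smul (a : ℝ) (u v w : TangentSpace 𝓘(ℝ, E) x) :
    curvature D x u v (a • w) = a • curvature D x u v w := by
  have h1 := smoothNear_extend w
  have h0 : SmoothFunNear (E := E) (fun _ : M ↦ a) x :=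
    Eventually.of_forall fun _ ↦ contMDiffAt_const
  rw [curvature, curvatureField_congr hD u v (SmoothNear.smul h0 h1) (eventually_extend_smul a w),
    curvatureField_smul hD u v h0 h1]
  rfl

omit hD [T2Space M] in
lemma curvature_antisymm (u v w : TangentSpace 𝓘(ℝ, E) x) :
    curvature D x u v w = -curvature D x v u w := by
  rw [curvature, curvature, curvatureField_extend, curvatureField_extend, neg_sub]

end Smooth

end Connections

/-! ### Curvature identities coming from parallel `J`, `g` and torsion. -/

section Parallel

variable {E : Type*} [NormedAddCommGroup E] [NormedSpace ℝ E] [FiniteDimensional ℝ E]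
  {M : Type*} [TopologicalSpace M] [ChartedSpace E M] [IsManifold 𝓘(ℝ, E) ∞ M] [T2Space M]
  {D : Connection E M} {X Y F G : Π x : M, TangentSpace 𝓘(ℝ, E) x} {f : M → ℝ} {x : M}
  (hD : D.ContMDiffCovariantDerivative ∞)

include hD

lemma curvature_J {S : ComplexStructure E M} (hJ : ParallelComplexStructure S D)
    (u v w : TangentSpace 𝓘(ℝ, E) x) :
    curvature D x u v (S.J x w) = S.J x (curvature D x u v w) := by
  have hW := smoothNear_extend w
  have key : ∀ a b : TangentSpace 𝓘(ℝ, E) x,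
      D (fun y ↦ D (fun z ↦ S.J z (FiberBundle.extend E w z)) y (FiberBundle.extend E a y)) x b
        = S.J x (D (fun y ↦ D (FiberBundle.extend E w) y (FiberBundle.extend E a y)) x b) := by
    intro a b
    have h1 := hW.conn hD (smoothNear_extend a)
    rw [← hJ _ x h1.diffAt, conn_congr (h1.J S).diffAt]
    filter_upwards [hW.eventually] with y hy
    exact hJ _ y hy.diffAt _
  have h1 := curvatureField_eq hD u v (hW.J S)
  simp only [FiberBundle.extend_apply_self] at h1
  rw [← h1, curvature, curvatureField_extend, curvatureField_extend, key, key, map_sub]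

/-- The function `g(W, Z)` has commuting second derivatives along coordinate fields. Expanding them
by metric compatibility, the mixed products cancel and the curvature terms remain. -/
lemma curvature_skew {g : Metric E M} (hg : ParallelMetric g D)
    (u v w z : TangentSpace 𝓘(ℝ, E) x) :
    g.inner x (curvature D x u v w) z = -g.inner x w (curvature D x u v z) := by
  have hW := smoothNear_extend w
  have hZ := smoothNear_extend z
  have key : ∀ a b : TangentSpace 𝓘(ℝ, E) x,
      mvfderiv 𝓘(ℝ, E) (fun y ↦ mvfderiv 𝓘(ℝ, E) (fun y ↦ g.inner y (FiberBundle.extend E w y)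
          (FiberBundle.extend E z y)) y (FiberBundle.extend E a y)) x b
        = g.inner x (D (fun y ↦ D (FiberBundle.extend E w) y (FiberBundle.extend E a y)) x b) z
          + g.inner x (D (FiberBundle.extend E w) x a) (D (FiberBundle.extend E z) x b)
          + (g.inner x (D (FiberBundle.extend E w) x b) (D (FiberBundle.extend E z) x a)
          + g.inner x w
            (D (fun y ↦ D (FiberBundle.extend E z) y (FiberBundle.extend E a y)) x b)) := by
    intro a b
    have h1 := hW.conn hD (smoothNear_extend a)
    have h2 := hZ.conn hD (smoothNear_extend a)
    have h3 : (fun y ↦ mvfderiv 𝓘(ℝ, E) (fun y ↦ g.inner y (FiberBundle.extend E w y)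
          (FiberBundle.extend E z y)) y (FiberBundle.extend E a y)) =ᶠ[𝓝 x]
        (fun y ↦ g.inner y (D (FiberBundle.extend E w) y (FiberBundle.extend E a y))
          (FiberBundle.extend E z y))
        + fun y ↦ g.inner y (FiberBundle.extend E w y)
          (D (FiberBundle.extend E z) y (FiberBundle.extend E a y)) := by
      filter_upwards [hW.eventually, hZ.eventually] with y hy hy'
      exact hg _ _ y hy.diffAt hy'.diffAt _
    rw [mvfderiv, h3.mfderiv_eq]
    change mvfderiv 𝓘(ℝ, E) _ x b = _
    rw [mvfderiv_add (h1.inner g hZ).mdifferentiableAt (hW.inner g h2).mdifferentiableAt,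
      _root_.add_apply, hg _ _ x h1.diffAt hZ.diffAt, hg _ _ x hW.diffAt h2.diffAt]
    simp only [FiberBundle.extend_apply_self]
  have h1 := (hW.inner g hZ).mvfderiv_mvfderiv_comm u v
  rw [key, key] at h1
  rw [curvature, curvature, curvatureField_extend, curvatureField_extend, map_sub, map_sub,
    _root_.sub_apply]
  linarith

/-- Differentiating `T(A, B)` twice by the Leibniz rule, the mixed terms are symmetric in the two
directions and drop out. -/
lemma curvature_torsion (hT : ParallelTorsion D) (u v a b : TangentSpace 𝓘(ℝ, E) x) :
    curvature D x u v (D.torsion x a b)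
      = D.torsion x (curvature D x u v a) b + D.torsion x a (curvature D x u v b) := by
  have hA := smoothNear_extend a
  have hB := smoothNear_extend b
  have key : ∀ p q : TangentSpace 𝓘(ℝ, E) x,
      D (fun y ↦ D (fun z ↦ D.torsion z (FiberBundle.extend E a z) (FiberBundle.extend E b z)) y
          (FiberBundle.extend E p y)) x q
        = D.torsion x (D (fun y ↦ D (FiberBundle.extend E a) y (FiberBundle.extend E p y)) x q) b
          + D.torsion x (D (FiberBundle.extend E a) x p) (D (FiberBundle.extend E b) x q)
          + (D.torsion x (D (FiberBundle.extend E a) x q) (D (FiberBundle.extend E b) x p)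
          + D.torsion x a
            (D (fun y ↦ D (FiberBundle.extend E b) y (FiberBundle.extend E p y)) x q)) := by
    intro p q
    have h1 := hA.conn hD (smoothNear_extend p)
    have h2 := hB.conn hD (smoothNear_extend p)
    have h3 : D (fun y ↦ D (fun z ↦ D.torsion z (FiberBundle.extend E a z)
          (FiberBundle.extend E b z)) y (FiberBundle.extend E p y)) x
        = D ((fun y ↦ D.torsion y (D (FiberBundle.extend E a) y (FiberBundle.extend E p y))
            (FiberBundle.extend E b y))
          + fun y ↦ D.torsion y (FiberBundle.extend E a y)
            (D (FiberBundle.extend E b) y (FiberBundle.extend E p y))) x := by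
      refine conn_congr ((h1.torsion hD hB).add (hA.torsion hD h2)).diffAt ?_
      filter_upwards [hA.eventually, hB.eventually] with y hy hy'
      exact hT _ _ y hy.diffAt hy'.diffAt _
    rw [h3, conn_add (h1.torsion hD hB).diffAt (hA.torsion hD h2).diffAt,
      _root_.add_apply, hT _ _ x h1.diffAt hB.diffAt, hT _ _ x hA.diffAt h2.diffAt]
    simp only [FiberBundle.extend_apply_self]
  have h1 := curvatureField_eq hD u v (hA.torsion hD hB)
  simp only [FiberBundle.extend_apply_self] at h1
  rw [← h1, curvature, curvature, curvatureField_extend, curvatureField_extend,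
    curvatureField_extend, key, key]
  simp only [map_sub, _root_.sub_apply]
  abel

/-- The first Bianchi identity for a connection with parallel torsion. -/
lemma curvature_bianchi (hT : ParallelTorsion D) (u v w : TangentSpace 𝓘(ℝ, E) x) :
    curvature D x u v w + curvature D x v w u + curvature D x w u v
      = D.torsion x (D.torsion x u v) w + D.torsion x (D.torsion x v w) u
        + D.torsion x (D.torsion x w u) v := by
  -- For coordinate fields `T(V, W) = ∇_V W - ∇_W V`; this is its derivative along `u`, computed
  -- with `∇T = 0`.
  have key : ∀ u v w : TangentSpace 𝓘(ℝ, E) x,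
      D (fun y ↦ D (FiberBundle.extend E w) y (FiberBundle.extend E v y)) x u
        - D (fun y ↦ D (FiberBundle.extend E v) y (FiberBundle.extend E w y)) x u
      = D.torsion x (D (FiberBundle.extend E v) x u) w
        + D.torsion x v (D (FiberBundle.extend E w) x u) := by
    intro u v w
    have hV := smoothNear_extend v
    have hW := smoothNear_extend w
    have h1 := hW.conn hD hV
    have h2 := hV.conn hD hW
    have h3 := hT _ _ x hV.diffAt hW.diffAt u
    simp only [FiberBundle.extend_apply_self] at h3
    rw [← h3, ← _root_.sub_apply, ← conn_sub h1.diffAt h2.diffAt]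
    rw [conn_congr (h1.sub h2).diffAt (eventually_torsion_extend v w)]
  simp only [curvature, curvatureField_extend]
  have k1 := key u v w
  have k2 := key v w u
  have k3 := key w u v
  simp only [torsion_extend (D := D) (x := x) u v, torsion_extend (D := D) (x := x) v w,
    torsion_extend (D := D) (x := x) w u, map_sub, _root_.sub_apply]
  rw [D.torsion_antisymm v] at k1
  rw [D.torsion_antisymm w] at k2
  rw [D.torsion_antisymm u] at k3
  linear_combination (norm := module) k1 + k2 + k3

end Parallel

/-! ### Comparison of the Chern and Bismut connections, and the vanishing of `c`. -/

section Pointwise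

variable {E : Type*} [NormedAddCommGroup E] [NormedSpace ℝ E]
  {M : Type*} [TopologicalSpace M] [ChartedSpace E M] [IsManifold 𝓘(ℝ, E) ∞ M]

/-- A continuous bilinear map on a tangent space as a bilinear map. -/
def bilin {x : M} {W : Type*} [TopologicalSpace W] [AddCommGroup W] [Module ℝ W]
    [IsTopologicalAddGroup W] [ContinuousConstSMul ℝ W]
    (B : TangentSpace 𝓘(ℝ, E) x →L[ℝ] TangentSpace 𝓘(ℝ, E) x →L[ℝ] W) :
    TangentSpace 𝓘(ℝ, E) x →ₗ[ℝ] TangentSpace 𝓘(ℝ, E) x →ₗ[ℝ] W :=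
  LinearMap.mk₂ ℝ (fun u v ↦ B u v) (by simp) (by simp) (by simp) (by simp)

omit [IsManifold 𝓘(ℝ, E) ∞ M] in
@[simp]
lemma bilin_apply {x : M} {W : Type*} [TopologicalSpace W] [AddCommGroup W] [Module ℝ W]
    [IsTopologicalAddGroup W] [ContinuousConstSMul ℝ W]
    (B : TangentSpace 𝓘(ℝ, E) x →L[ℝ] TangentSpace 𝓘(ℝ, E) x →L[ℝ] W)
    (u v : TangentSpace 𝓘(ℝ, E) x) : bilin B u v = B u v := rfl

variable {S : ComplexStructure E M} {g : Metric E M} {D Dc : Connection E M} {x : M}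

lemma IsHermitian.hermitianPair (hg : IsHermitian S g) (x : M) :
    HermitianPair (bilin (g.inner x)) (S.J x).toLinearMap where
  symm := g.symm x
  pos := g.pos x
  sq := S.sq x
  inner_J := hg x

variable [FiniteDimensional ℝ E]

lemma IsBismut.bismutTorsion (hD : IsBismut S g D) (x : M) :
    BismutTorsion (bilin (g.inner x)) (S.J x).toLinearMap (bilin (D.torsion x)) where
  antisymm := D.torsion_antisymm
  skew := hD.torsion x
  nijenhuis := by
    intro u v
    have hU := smoothNear_extend u
    have hV := smoothNear_extend v
    have hi := S.integrable _ _ x hU.diffAt hV.diffAt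
    have t1 := torsion_eq (D := D) hU.diffAt hV.diffAt
    have t2 := torsion_eq (D := D) (hU.J S).diffAt (hV.J S).diffAt
    have t3 := torsion_eq (D := D) (hU.J S).diffAt hV.diffAt
    have t4 := torsion_eq (D := D) hU.diffAt (hV.J S).diffAt
    simp only [hD.complex _ x hU.diffAt, hD.complex _ x hV.diffAt,
      FiberBundle.extend_apply_self] at t1 t2 t3 t4
    simp only [bilin_apply, ContinuousLinearMap.coe_coe]
    have Jt3 := congrArg (S.J x) t3
    have Jt4 := congrArg (S.J x) t4
    simp only [map_sub, S.sq] at Jt3 Jt4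
    linear_combination (norm := module) t1 - t2 + Jt3 + Jt4 - hi

/-- The Chern connection differs from the Bismut connection by the tensor `chernDifference`. -/
lemma chern_apply (hg : IsHermitian S g) (hD : IsBismut S g D) (hDc : IsChern S g Dc)
    {F : Π x : M, TangentSpace 𝓘(ℝ, E) x} (hF : DiffAt F x) (u : TangentSpace 𝓘(ℝ, E) x) :
    Dc F x u = D F x u
      + chernDifference (S.J x).toLinearMap (bilin (D.torsion x)) u (F x) := by
  have h := hg.hermitianPair x
  have ht := hD.bismutTorsion x
  let Δ := Dc.difference D x
  have hΔ : ∀ {F : Π x : M, TangentSpace 𝓘(ℝ, E) x}, DiffAt F x → ∀ u,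
      Δ (F x) u = Dc F x u - D F x u := fun hF u ↦ by
    have := IsCovariantDerivativeOn.difference_apply Dc.isCovariantDerivativeOnUniv
      D.isCovariantDerivativeOnUniv (x := x) (Set.mem_univ x) hF
    exact congrArg (fun L : TangentSpace 𝓘(ℝ, E) x →L[ℝ] TangentSpace 𝓘(ℝ, E) x ↦ L u) this
  have hΔe : ∀ u v, Δ v u = Dc (FiberBundle.extend E v) x u - D (FiberBundle.extend E v) x u :=
    fun u v ↦ by
      have := hΔ (smoothNear_extend v).diffAt u
      rwa [FiberBundle.extend_apply_self] at this
  let A : TangentSpace 𝓘(ℝ, E) x → TangentSpace 𝓘(ℝ, E) x → TangentSpace 𝓘(ℝ, E) x :=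
    chernDifference (S.J x).toLinearMap (bilin (D.torsion x))
  -- `B` is the error between the true difference tensor and the proposed one; `difference_eq_zero`
  -- is the uniqueness of the Chern connection.
  let B : TangentSpace 𝓘(ℝ, E) x →ₗ[ℝ] TangentSpace 𝓘(ℝ, E) x →ₗ[ℝ] TangentSpace 𝓘(ℝ, E) x :=
    LinearMap.mk₂ ℝ (fun u v ↦ Δ v u - A u v)
      (fun _ _ _ ↦ by simp only [A, chernDifference, map_add, LinearMap.add_apply]; module)
      (fun _ _ _ ↦ by simp only [A, chernDifference, map_smul, LinearMap.smul_apply]; module)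
      (fun _ _ _ ↦ by simp only [A, chernDifference, map_add, _root_.add_apply]; module)
      (fun _ _ _ ↦ by simp only [A, chernDifference, map_smul, _root_.smul_apply]; module)
  have hB : ∀ u v, B u v = Δ v u - A u v := fun u v ↦ rfl
  have hJ : ∀ u v, Δ (S.J x v) u = S.J x (Δ v u) := fun u v ↦ by
    have hV := smoothNear_extend v
    have h1 := hΔ (hV.J S).diffAt u
    rw [hD.complex _ x hV.diffAt, hDc.complex _ x hV.diffAt, ← map_sub, ← hΔ hV.diffAt] at h1
    simpa only [FiberBundle.extend_apply_self] using h1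
  have h0 : B u (F x) = 0 := by
    refine h.difference_eq_zero ?_ ?_ ?_ u (F x)
    · intro u v w
      have hV := smoothNear_extend v
      have hW := smoothNear_extend w
      have h1 := hD.metric _ _ x hV.diffAt hW.diffAt u
      have h2 := hDc.metric _ _ x hV.diffAt hW.diffAt u
      simp only [FiberBundle.extend_apply_self] at h1 h2
      have h3 := BismutTorsion.chernDifference_skew h ht u v w
      simp only [hB, map_sub, LinearMap.sub_apply]
      rw [h3, bilin_apply, bilin_apply, hΔe, hΔe, map_sub, map_sub, _root_.sub_apply]
      change _ = -(_ - bilin (g.inner x) v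
        (chernDifference (S.J x).toLinearMap (bilin (D.torsion x)) u w))
      simp only [bilin_apply]
      linarith
    · intro u v
      rw [hB, hB, map_sub]
      exact congrArg₂ _ (hJ u v) (BismutTorsion.chernDifference_J h u v)
    · intro u v
      -- Antisymmetrising `B` gives the Chern torsion minus its proposed value, and both of these
      -- have no `(1,1)`-part.
      have tor : ∀ u v, B u v - B v u
          = Dc.torsion x u v - chernTorsion (S.J x).toLinearMap (bilin (D.torsion x)) u v := by
        intro u v
        have h1 := BismutTorsion.chernDifference_torsion h ht u v
        rw [hB, hB, hΔe, hΔe, torsion_extend, ← h1, bilin_apply, torsion_extend]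
        change _ = _ - (_ + A u v - A v u)
        abel
      rw [tor, tor, BismutTorsion.chernTorsion_J_left h ht,
        BismutTorsion.chernTorsion_J_right h ht]
      exact congrArg₂ _ (hDc.torsion x u v) rfl
  have h1 := hΔ hF u
  have h2 : Δ (F x) u = A u (F x) := sub_eq_zero.1 h0
  rw [h2] at h1
  change _ = _ + A u (F x)
  rw [h1]
  abel

variable [T2Space M]

lemma SmoothNear.chernDifference (hD : IsBismut S g D) {X Y : Π x : M, TangentSpace 𝓘(ℝ, E) x}
    (hX : SmoothNear X x) (hY : SmoothNear Y x) :
    SmoothNear (fun y ↦ HermitianGeometry.chernDifference (S.J y).toLinearMap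
      (bilin (D.torsion y)) (X y) (Y y)) x :=
  ((hX.torsion hD.smooth hY).sub ((hX.torsion hD.smooth (hY.J S)).J S)).const_smul _

/-- The difference tensor is built from `T` and `J`, both parallel, so it is itself Bismut-parallel.
-/
lemma conn_chernDifference (hD : IsBismut S g D) (hT : ParallelTorsion D)
    {X Y : Π x : M, TangentSpace 𝓘(ℝ, E) x}
    (hX : SmoothNear X x) (hY : SmoothNear Y x) (u : TangentSpace 𝓘(ℝ, E) x) :
    D (fun y ↦ chernDifference (S.J y).toLinearMap (bilin (D.torsion y)) (X y) (Y y)) x u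
      = chernDifference (S.J x).toLinearMap (bilin (D.torsion x)) (D X x u) (Y x)
        + chernDifference (S.J x).toLinearMap (bilin (D.torsion x)) (X x) (D Y x u) := by
  have h1 := hX.torsion hD.smooth hY
  have h2 := hX.torsion hD.smooth (hY.J S)
  have h3 : (fun y ↦ chernDifference (S.J y).toLinearMap (bilin (D.torsion y)) (X y) (Y y))
      = (-(1 / 2) : ℝ) • ((fun y ↦ D.torsion y (X y) (Y y))
        - fun y ↦ S.J y (D.torsion y (X y) (S.J y (Y y)))) := rfl
  rw [h3, conn_const_smul _ (h1.sub (h2.J S)).diffAt, conn_sub h1.diffAt (h2.J S).diffAt,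
    _root_.smul_apply, _root_.sub_apply, hT _ _ x hX.diffAt hY.diffAt, hD.complex _ x h2.diffAt,
    hT _ _ x hX.diffAt (hY.J S).diffAt, hD.complex _ x hY.diffAt]
  simp only [chernDifference, bilin_apply, ContinuousLinearMap.coe_coe, map_add]
  module

/-- The curvature of the Chern connection in terms of that of a Bismut connection with parallel
torsion. -/
lemma chern_curvature (hg : IsHermitian S g) (hD : IsBismut S g D) (hT : ParallelTorsion D)
    (hDc : IsChern S g Dc) (u v w : TangentSpace 𝓘(ℝ, E) x) :
    curvature Dc x u v w = curvature D x u v w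
      + chernDifference (S.J x).toLinearMap (bilin (D.torsion x)) (D.torsion x u v) w
      + (chernDifference (S.J x).toLinearMap (bilin (D.torsion x)) u
          (chernDifference (S.J x).toLinearMap (bilin (D.torsion x)) v w)
        - chernDifference (S.J x).toLinearMap (bilin (D.torsion x)) v
          (chernDifference (S.J x).toLinearMap (bilin (D.torsion x)) u w)) := by
  have hW := smoothNear_extend w
  -- No derivative of the difference tensor appears. On antisymmetrising in `a` and `b`, the terms
  -- differentiating the extension of `a` produce the torsion, and the terms linear in `D w` cancel.
  have key : ∀ a b : TangentSpace 𝓘(ℝ, E) x,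
      Dc (fun y ↦ Dc (FiberBundle.extend E w) y (FiberBundle.extend E a y)) x b
        = D (fun y ↦ D (FiberBundle.extend E w) y (FiberBundle.extend E a y)) x b
          + (chernDifference (S.J x).toLinearMap (bilin (D.torsion x))
              (D (FiberBundle.extend E a) x b) w
            + chernDifference (S.J x).toLinearMap (bilin (D.torsion x)) a
              (D (FiberBundle.extend E w) x b))
          + chernDifference (S.J x).toLinearMap (bilin (D.torsion x)) b
            (D (FiberBundle.extend E w) x a
              + chernDifference (S.J x).toLinearMap (bilin (D.torsion x)) a w) := by
    intro a b
    have hA := smoothNear_extend a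
    have h1 := hW.conn hD.smooth hA
    have h2 := hA.chernDifference hD hW
    have h3 : Dc (fun y ↦ Dc (FiberBundle.extend E w) y (FiberBundle.extend E a y)) x
        = Dc ((fun y ↦ D (FiberBundle.extend E w) y (FiberBundle.extend E a y))
          + fun y ↦ chernDifference (S.J y).toLinearMap (bilin (D.torsion y))
            (FiberBundle.extend E a y) (FiberBundle.extend E w y)) x := by
      refine conn_congr (h1.add h2).diffAt ?_
      filter_upwards [hW.eventually] with y hy
      exact chern_apply hg hD hDc hy.diffAt _
    rw [h3, chern_apply hg hD hDc (h1.add h2).diffAt, conn_add h1.diffAt h2.diffAt,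
      _root_.add_apply, conn_chernDifference hD hT hA hW]
    simp only [FiberBundle.extend_apply_self, Pi.add_apply]
  rw [curvature, curvature, curvatureField_extend, curvatureField_extend, key, key, torsion_extend]
  rw [chernDifference_sub_left, chernDifference_add_right, chernDifference_add_right]
  abel

/-- The curvature of a connection at a point, linear in the last argument. -/
def curvatureLin (hD : D.ContMDiffCovariantDerivative ∞) (x : M) (u v : TangentSpace 𝓘(ℝ, E) x) :
    TangentSpace 𝓘(ℝ, E) x →ₗ[ℝ] TangentSpace 𝓘(ℝ, E) x where
  toFun := curvature D x u v
  map_add' := curvature_add hD u v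
  map_smul' a := curvature_smul hD a u v

lemma IsBismut.bismutCurvature (hD : IsBismut S g D) (hT : ParallelTorsion D) (x : M) :
    BismutCurvature (bilin (g.inner x)) (S.J x).toLinearMap (bilin (D.torsion x))
      (curvatureLin hD.smooth x) where
  antisymm := curvature_antisymm
  skew := curvature_skew hD.smooth hD.metric
  commute := curvature_J hD.smooth hD.complex
  derivation := curvature_torsion hD.smooth hT
  bianchi := curvature_bianchi hD.smooth hT

/-- If the Lee vector does not vanish at some point, then constant mixed curvature is zero. -/
theorem eq_zero_of_leeVector_ne_zero {n : ℕ} (hn : Module.finrank ℝ E = 2 * n)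
    (hg : IsHermitian S g) (hD : IsBismut S g D) (hT : ParallelTorsion D) {α β c : ℝ}
    (hc : HasConstantMixedCurvature n S g α β c) {e : Fin n → TangentSpace 𝓘(ℝ, E) x}
    (he : IsUnitaryFrame S g x e)
    (hξ : leeVector (S.J x).toLinearMap (bilin (D.torsion x)) e ≠ 0) : c = 0 := by
  obtain ⟨Dc, hDc, hmix⟩ := hc
  have h := hg.hermitianPair x
  set ξ := leeVector (S.J x).toLinearMap (bilin (D.torsion x)) e with hξdef
  have hp : 0 < g.inner x ξ ξ := g.pos x ξ hξ
  have hfin : FiniteDimensional ℝ (TangentSpace 𝓘(ℝ, E) x) :=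
    inferInstanceAs (FiniteDimensional ℝ E)
  set r := (Real.sqrt (g.inner x ξ ξ))⁻¹ with hr
  have h1 : g.inner x (r • ξ) (r • ξ) = 1 := by
    have := Real.mul_self_sqrt hp.le
    have h2 : Real.sqrt (g.inner x ξ ξ) ≠ 0 := (Real.sqrt_pos.2 hp).ne'
    simp only [map_smul, _root_.smul_apply, smul_eq_mul, hr]
    field_simp
    nlinarith
  obtain ⟨hH, hRic⟩ := BismutCurvature.chern_leeVector h (hD.bismutTorsion x)
    (hD.bismutCurvature hT x) (n := n) hn (e := e) he (Rc := curvature Dc x)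
    (chern_curvature hg hD hT hDc) r (u := r • ξ) rfl
  have h2 := hmix x e (r • ξ) he h1
  rw [← h2, mixedCurvature]
  simp only [bisectional]
  have e1 : ∑ i, g.inner x (curvature Dc x (r • ξ) (S.J x (r • ξ)) (S.J x (e i))) (e i) = 0 := hRic
  have e2 : g.inner x (curvature Dc x (r • ξ) (S.J x (r • ξ)) (S.J x (r • ξ))) (r • ξ) = 0 := hH
  rw [e1, e2]
  ring

end Pointwise

/-! ### Exterior powers of a bilinear form. -/

section Wedge

lemma sum_fin_two_mul {A : Type*} [AddCommMonoid A] {k : ℕ} (f : Fin (2 * k) → A) :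
    ∑ j, f j = ∑ i : Fin k, (f ⟨2 * i, by omega⟩ + f ⟨2 * i + 1, by omega⟩) := by
  induction k with
  | zero => simp
  | succ k ih =>
    have h1 : ∑ j, f j = ∑ j : Fin (2 * k + 1 + 1), f j := rfl
    rw [h1, Fin.sum_univ_castSucc, Fin.sum_univ_castSucc, Fin.sum_univ_castSucc, add_assoc]
    exact congrArg₂ _ (ih fun j ↦ f j.castSucc.castSucc) rfl

variable {V : Type*} [AddCommGroup V] [Module ℝ V]

/-- The multilinear form `∏ i, w (v (2 * i)) (v (2 * i + 1))`. -/
def pairProd (w : V →ₗ[ℝ] V →ₗ[ℝ] ℝ) (k : ℕ) : MultilinearMap ℝ (fun _ : Fin (2 * k) ↦ V) ℝ :=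
  MultilinearMap.mk'
    (fun v ↦ ∏ i : Fin k, w (v ⟨2 * i, by omega⟩) (v ⟨2 * i + 1, by omega⟩))
    (by
      intro v j a b
      refine (Finset.prod_add_prod_eq (i := ⟨j / 2, by omega⟩) (Finset.mem_univ _) ?_ ?_ ?_).symm
      · rcases Nat.mod_two_eq_zero_or_one j with hj | hj
        · have h1 : (⟨2 * (j / 2), by omega⟩ : Fin (2 * k)) = j := Fin.ext (by simp; omega)
          have h2 : (⟨2 * (j / 2) + 1, by omega⟩ : Fin (2 * k)) ≠ j := fun h ↦ by
            have := congrArg Fin.val h; simp at this; omega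
          simp [h1, h2]
        · have h1 : (⟨2 * (j / 2) + 1, by omega⟩ : Fin (2 * k)) = j := Fin.ext (by simp; omega)
          have h2 : (⟨2 * (j / 2), by omega⟩ : Fin (2 * k)) ≠ j := fun h ↦ by
            have := congrArg Fin.val h; simp at this; omega
          simp [h1, h2]
      all_goals
        intro i _ hi
        have h1 : (⟨2 * i, by omega⟩ : Fin (2 * k)) ≠ j := fun h ↦ hi (by ext; simp [← h])
        have h2 : (⟨2 * i + 1, by omega⟩ : Fin (2 * k)) ≠ j :=
          fun h ↦ hi (by ext; simp [← h]; omega)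
        simp [h1, h2])
    (by
      intro v j c a
      have key : ∀ i : Fin k, w (Function.update v j (c • a) ⟨2 * i, by omega⟩)
          (Function.update v j (c • a) ⟨2 * i + 1, by omega⟩)
          = (if i = ⟨j / 2, by omega⟩ then c else 1)
            * w (Function.update v j a ⟨2 * i, by omega⟩)
              (Function.update v j a ⟨2 * i + 1, by omega⟩) := by
        intro i
        simp only [Function.update_apply, Fin.ext_iff]
        rcases lt_trichotomy (i : ℕ) (j / 2) with h | h | h
        · simp [h.ne, show 2 * (i : ℕ) ≠ j by omega, show 2 * (i : ℕ) + 1 ≠ j by omega]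
        · rcases Nat.mod_two_eq_zero_or_one j with hj | hj
          · simp [h, show 2 * ((j : ℕ) / 2) = j by omega]
          · simp [h, show 2 * ((j : ℕ) / 2) + 1 = j by omega,
              show 2 * ((j : ℕ) / 2) ≠ j by omega]
        · simp [h.ne', show 2 * (i : ℕ) ≠ j by omega, show 2 * (i : ℕ) + 1 ≠ j by omega]
      simp only [key, Finset.prod_mul_distrib]
      simp)

lemma pairProd_apply (w : V →ₗ[ℝ] V →ₗ[ℝ] ℝ) {k : ℕ} (v : Fin (2 * k) → V) :
    pairProd w k v = ∏ i : Fin k, w (v ⟨2 * i, by omega⟩) (v ⟨2 * i + 1, by omega⟩) := rfl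

/-- Leibniz rule: the slots `2i` and `2i + 1` both belong to the `i`-th factor. -/
lemma sum_pairProd_update (w : V →ₗ[ℝ] V →ₗ[ℝ] ℝ) {k : ℕ} (A : V → V) (v : Fin (2 * k) → V) :
    ∑ j, pairProd w k (Function.update v j (A (v j)))
      = ∑ i : Fin k, (∏ j ∈ Finset.univ.erase i,
          w (v ⟨2 * j, by omega⟩) (v ⟨2 * j + 1, by omega⟩))
        * (w (A (v ⟨2 * i, by omega⟩)) (v ⟨2 * i + 1, by omega⟩)
          + w (v ⟨2 * i, by omega⟩) (A (v ⟨2 * i + 1, by omega⟩))) := by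
  rw [sum_fin_two_mul]
  refine Finset.sum_congr rfl fun i _ ↦ ?_
  have key : ∀ (l : Fin (2 * k)) (z : V), (l : ℕ) / 2 = i → pairProd w k (Function.update v l z)
      = (∏ j ∈ Finset.univ.erase i, w (v ⟨2 * j, by omega⟩) (v ⟨2 * j + 1, by omega⟩))
        * w (Function.update v l z ⟨2 * i, by omega⟩)
          (Function.update v l z ⟨2 * i + 1, by omega⟩) := by
    intro l z hl
    rw [pairProd_apply, ← Finset.prod_erase_mul _ _ (Finset.mem_univ i)]
    congr 1
    refine Finset.prod_congr rfl fun j hj ↦ ?_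
    have hji : (j : ℕ) ≠ i := fun h ↦ (Finset.mem_erase.1 hj).1 (Fin.ext h)
    simp [Fin.ext_iff, show 2 * (j : ℕ) ≠ l by omega,
      show 2 * (j : ℕ) + 1 ≠ l by omega]
  rw [key _ _ (by simp), key _ _ (by simp; omega)]
  simp [Fin.ext_iff, mul_add]

/-- The exterior power `wedgePow w k` as an alternating map. -/
def wedgeForm (w : V →ₗ[ℝ] V →ₗ[ℝ] ℝ) (k : ℕ) : V [⋀^Fin (2 * k)]→ₗ[ℝ] ℝ :=
  (1 / 2 : ℝ) ^ k • MultilinearMap.alternatization (pairProd w k)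

lemma wedgeForm_apply (w : V →ₗ[ℝ] V →ₗ[ℝ] ℝ) {k : ℕ} (v : Fin (2 * k) → V) :
    wedgeForm w k v = (1 / 2 : ℝ) ^ k * ∑ σ : Equiv.Perm (Fin (2 * k)),
      ((Equiv.Perm.sign σ : ℤ) : ℝ) * pairProd w k (v ∘ σ) := by
  simp only [wedgeForm, AlternatingMap.smul_apply, MultilinearMap.alternatization_apply,
    smul_eq_mul, Units.smul_def, zsmul_eq_mul]
  rfl

lemma wedgeForm_congr {w : V →ₗ[ℝ] V →ₗ[ℝ] ℝ} {k : ℕ} {v z : Fin (2 * k) → V}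
    (h : ∀ a b, w (v a) (v b) = w (z a) (z b)) : wedgeForm w k v = wedgeForm w k z := by
  simp only [wedgeForm_apply, pairProd_apply, Function.comp_apply, h]

/-- In every term of the permutation sum some factor contains `v a`. -/
lemma wedgeForm_eq_zero {w : V →ₗ[ℝ] V →ₗ[ℝ] ℝ} {k : ℕ} {v : Fin (2 * k) → V} (a : Fin (2 * k))
    (h : ∀ b, w (v a) (v b) = 0) (h' : ∀ b, w (v b) (v a) = 0) : wedgeForm w k v = 0 := by
  rw [wedgeForm_apply, Finset.sum_eq_zero, mul_zero]
  intro σ _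
  rw [pairProd_apply, Finset.prod_eq_zero (Finset.mem_univ (⟨σ.symm a / 2, by omega⟩ : Fin k)),
    mul_zero]
  rcases Nat.mod_two_eq_zero_or_one (σ.symm a) with hj | hj
  · have h1 : (⟨2 * (σ.symm a / 2), by omega⟩ : Fin (2 * k)) = σ.symm a :=
      Fin.ext (by simp; omega)
    simp [h1, h]
  · have h1 : (⟨2 * (σ.symm a / 2) + 1, by omega⟩ : Fin (2 * k)) = σ.symm a :=
      Fin.ext (by simp; omega)
    simp [h1, h']

lemma sum_wedgeForm_update (w : V →ₗ[ℝ] V →ₗ[ℝ] ℝ) {k : ℕ} (A : V → V) (v : Fin (2 * k) → V) :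
    ∑ j, wedgeForm w k (Function.update v j (A (v j)))
      = (1 / 2 : ℝ) ^ k * ∑ σ : Equiv.Perm (Fin (2 * k)), ((Equiv.Perm.sign σ : ℤ) : ℝ) *
        ∑ i : Fin k, (∏ j ∈ Finset.univ.erase i,
            w (v (σ ⟨2 * j, by omega⟩)) (v (σ ⟨2 * j + 1, by omega⟩)))
          * (w (A (v (σ ⟨2 * i, by omega⟩))) (v (σ ⟨2 * i + 1, by omega⟩))
            + w (v (σ ⟨2 * i, by omega⟩)) (A (v (σ ⟨2 * i + 1, by omega⟩)))) := by
  simp only [wedgeForm_apply]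
  rw [← Finset.mul_sum, Finset.sum_comm]
  congr 1
  refine Finset.sum_congr rfl fun σ _ ↦ ?_
  rw [← Finset.mul_sum]
  congr 1
  rw [← Equiv.sum_comp σ]
  have := sum_pairProd_update w A (v ∘ σ)
  simp only [Function.comp_apply] at this
  rw [← this]
  refine Finset.sum_congr rfl fun j _ ↦ ?_
  rw [Function.update_comp_equiv]
  simp

/-- Writing the derivation induced by `A` as an alternatization turns the exterior derivative into a
double alternatization, in which only the skew part of the Christoffel symbol, the torsion,
survives. -/
lemma alternatizeUncurryFin_curryLeft_comp {m : ℕ} (W : V [⋀^Fin (m + 1)]→ₗ[ℝ] ℝ) (A : V →ₗ[ℝ] V)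
    (v : Fin (m + 1) → V) :
    AlternatingMap.alternatizeUncurryFin (W.curryLeft ∘ₗ A) v
      = ∑ j, W (Function.update v j (A (v j))) := by
  rw [AlternatingMap.alternatizeUncurryFin_apply]
  refine Finset.sum_congr rfl fun j _ ↦ ?_
  rw [← Fin.insertNth_removeNth, AlternatingMap.map_insertNth]
  simp

end Wedge

/-! ### Evaluation of the torsion part of `d(ωⁿ⁻¹)` on unitary frames. -/

section Balanced

variable {V : Type*} [AddCommGroup V] [Module ℝ V]
  {g : V →ₗ[ℝ] V →ₗ[ℝ] ℝ} {J : V →ₗ[ℝ] V} {T : V →ₗ[ℝ] V →ₗ[ℝ] V}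

/-- The sequence `e₀, Je₀, e₁, Je₁, …`, continued by zeros. -/
def frameSeq (J : V →ₗ[ℝ] V) {n : ℕ} (e : Fin n → V) (k : ℕ) : V :=
  if hk : k / 2 < n then if k % 2 = 0 then e ⟨k / 2, hk⟩ else J (e ⟨k / 2, hk⟩) else 0

lemma frameSeq_even (J : V →ₗ[ℝ] V) {n : ℕ} (e : Fin n → V) (i : Fin n) :
    frameSeq J e (2 * i) = e i := by
  simp [frameSeq]

lemma frameSeq_odd (J : V →ₗ[ℝ] V) {n : ℕ} (e : Fin n → V) (i : Fin n) :
    frameSeq J e (2 * i + 1) = J (e i) := by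
  simp [frameSeq, show (2 * (i : ℕ) + 1) / 2 = i by omega]

namespace HermitianPair

variable (h : HermitianPair g J) {n : ℕ} {e : Fin n → V}
include h

lemma sum_frameSeq [FiniteDimensional ℝ V] (hn : Module.finrank ℝ V = 2 * n)
    (he : UnitaryFamily g J e) (u : V) :
    u = ∑ k : Fin (2 * n), g u (frameSeq J e k) • frameSeq J e k := by
  rw [sum_fin_two_mul]
  simp only [frameSeq_even, frameSeq_odd]
  exact h.sum_frame hn he u

/-- The fundamental form on the vectors of a unitary frame. -/
lemma kahler_frameSeq (he : UnitaryFamily g J e) {a b : ℕ} (ha : a < 2 * n) (hb : b < 2 * n) :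
    g (J (frameSeq J e a)) (frameSeq J e b)
      = if a / 2 = b / 2 then ((b % 2 : ℕ) : ℝ) - ((a % 2 : ℕ) : ℝ) else 0 := by
  have ha' : a / 2 < n := by omega
  have hb' : b / 2 < n := by omega
  have h1 := he ⟨a / 2, ha'⟩ ⟨b / 2, hb'⟩
  simp only [Fin.mk.injEq] at h1
  rcases Nat.mod_two_eq_zero_or_one a with hm | hm <;>
    rcases Nat.mod_two_eq_zero_or_one b with hm' | hm' <;>
    simp [frameSeq, ha', hb', hm, hm', h.inner_J_left, h.sq, h1]
  split_ifs <;> simp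

end HermitianPair

/-- The fundamental form of `g` and `J`. -/
def fundamentalForm (g : V →ₗ[ℝ] V →ₗ[ℝ] ℝ) (J : V →ₗ[ℝ] V) : V →ₗ[ℝ] V →ₗ[ℝ] ℝ := g ∘ₗ J

lemma fundamentalForm_apply (u v : V) : fundamentalForm g J u v = g (J u) v := rfl

/-- The `a`-th term of the sequence of natural numbers other than `p` and `q`, for `p < q`. -/
def skipTwo (p q a : ℕ) : ℕ := if a < p then a else if a + 1 < q then a + 1 else a + 2

lemma skipTwo_ne_left {p q : ℕ} (a : ℕ) : skipTwo p q a ≠ p := by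
  unfold skipTwo; split_ifs <;> omega

lemma skipTwo_lt {p q a k : ℕ} (ha : a < k) : skipTwo p q a < k + 2 := by
  unfold skipTwo; split_ifs <;> omega

lemma exists_skipTwo_eq {p q k b : ℕ} (hpq : p < q) (hq : q < k + 2) (hb : b < k + 2)
    (hbp : b ≠ p) (hbq : b ≠ q) : ∃ a < k, skipTwo p q a = b := by
  rcases lt_or_ge b p with h1 | h1
  · exact ⟨b, by omega, by simp [skipTwo, h1]⟩
  rcases lt_or_ge b q with h2 | h2
  · exact ⟨b - 1, by omega, by unfold skipTwo; split_ifs <;> omega⟩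
  · exact ⟨b - 2, by omega, by unfold skipTwo; split_ifs <;> omega⟩

-- Index bookkeeping: the list `s 1, s 2, …` loses its entries `i` and `j + 1`, which are the terms
-- `i + 1` and `j + 2` of `s`, and `s 0` is put back in front.
omit [AddCommGroup V] [Module ℝ V] in
lemma vecCons_removeNth_removeNth {N : ℕ} (s : ℕ → V) {i j : Fin (N + 1)} (hij : i ≤ j) :
    (Matrix.vecCons (s 0) (j.removeNth (i.castSucc.removeNth fun a : Fin (N + 2) ↦ s (a + 1))) :
      Fin (N + 1) → V) = fun a : Fin (N + 1) ↦ s (skipTwo (i + 1) (j + 2) a) := by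
  have hij' : (i : ℕ) ≤ j := hij
  funext a
  induction a using Fin.cases with
  | zero => simp [skipTwo]
  | succ a =>
    simp only [Matrix.cons_val_succ, Fin.removeNth_apply]
    congr 1
    simp only [Fin.succAbove, skipTwo, Fin.lt_def, Fin.val_castSucc, Fin.val_succ]
    split_ifs <;> simp_all <;> omega

section Evaluation

variable (h : HermitianPair g J) {m : ℕ} {e : Fin (m + 2) → V} (he : UnitaryFamily g J e)
include h he

/-- The exterior power of the fundamental form vanishes on all but two vectors of a unitary frame,
unless the two omitted vectors are `e_t` and `Je_t`. -/
lemma wedgeForm_skipTwo_eq_zero {p q : ℕ} (hpq : p < q) (hq : q < 2 * (m + 1) + 2)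
    (hne : p % 2 = 1 ∨ q ≠ p + 1) :
    wedgeForm (fundamentalForm g J) (m + 1) (fun a ↦ frameSeq J e (skipTwo p q a)) = 0 := by
  -- `b` is the partner of `p` under `J`. It differs from `q` and so is still present, but with `p`
  -- omitted it is `ω`-orthogonal to all remaining vectors.
  obtain ⟨b, hb, hbp⟩ : ∃ b, b / 2 = p / 2 ∧ b ≠ p :=
    ⟨p / 2 * 2 + (1 - p % 2), by omega, by omega⟩
  obtain ⟨a, ha, hab⟩ := exists_skipTwo_eq hpq hq (b := b) (by omega) hbp (by omega)
  have key : ∀ c : Fin (2 * (m + 1)), (skipTwo p q c / 2 = b / 2) →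
      skipTwo p q c % 2 = b % 2 := by
    intro c hc
    have := skipTwo_ne_left (p := p) (q := q) (c : ℕ)
    omega
  refine wedgeForm_eq_zero ⟨a, ha⟩ (fun c ↦ ?_) (fun c ↦ ?_)
  all_goals
    have hc := skipTwo_lt (p := p) (q := q) c.2
    rw [fundamentalForm_apply, hab, h.kahler_frameSeq he (by omega) (by omega)]
    split_ifs with h1
    · rw [key c (by omega), sub_self]
    · rfl

/-- The value of the exterior power of the fundamental form on a unitary frame without `e_t` and
`Je_t` does not depend on `t`. -/
lemma wedgeForm_skipTwo_pair (t : ℕ) :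
    wedgeForm (fundamentalForm g J) (m + 1)
        (fun a ↦ frameSeq J e (skipTwo (2 * t) (2 * t + 1) a))
      = wedgeForm (fundamentalForm g J) (m + 1) (fun a ↦ frameSeq J e a) := by
  refine wedgeForm_congr fun a b ↦ ?_
  have ha := skipTwo_lt (p := 2 * t) (q := 2 * t + 1) a.2
  have hb := skipTwo_lt (p := 2 * t) (q := 2 * t + 1) b.2
  rw [fundamentalForm_apply, fundamentalForm_apply, h.kahler_frameSeq he (by omega) (by omega),
    h.kahler_frameSeq he (by omega) (by omega)]
  have key : ∀ c : ℕ, skipTwo (2 * t) (2 * t + 1) c % 2 = c % 2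
      ∧ skipTwo (2 * t) (2 * t + 1) c / 2 = if c / 2 < t then c / 2 else c / 2 + 1 := by
    intro c
    unfold skipTwo
    constructor <;> split_ifs <;> omega
  rw [(key a).1, (key b).1, (key a).2, (key b).2]
  congr 1
  apply propext
  split_ifs <;> omega


/-- Only the `e₀`-component of the torsion matters. -/
lemma curryLeft_torsion_frameSeq [FiniteDimensional ℝ V] (ht : BismutTorsion g J T)
    (hn : Module.finrank ℝ V = 2 * (m + 2)) (W : V [⋀^Fin (2 * m + 1 + 1)]→ₗ[ℝ] ℝ)
    {i j : Fin (2 * m + 1 + 1)} (hij : i ≤ j) :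
    W.curryLeft (T (frameSeq J e (i + 1)) (frameSeq J e (j + 2)))
        (j.removeNth (i.castSucc.removeNth fun a : Fin (2 * m + 1 + 2) ↦ frameSeq J e (a + 1)))
      = g (T (frameSeq J e (i + 1)) (frameSeq J e (j + 2))) (frameSeq J e 0)
        * W (fun a ↦ frameSeq J e (skipTwo (i + 1) (j + 2) a)) := by
  have hij' : (i : ℕ) ≤ j := hij
  rw [← vecCons_removeNth_removeNth (frameSeq J e) hij]
  set z := T (frameSeq J e (i + 1)) (frameSeq J e (j + 2)) with hz
  set r := j.removeNth (i.castSucc.removeNth fun a : Fin (2 * m + 1 + 2) ↦ frameSeq J e (a + 1))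
    with hr
  have h1 : W.curryLeft z r = ∑ k : Fin (2 * (m + 2)), g z (frameSeq J e k)
      * W (Matrix.vecCons (frameSeq J e k) r) := by
    let ℓ : V →ₗ[ℝ] ℝ :=
      { toFun u := W.curryLeft u r, map_add' := by simp, map_smul' := by simp }
    have h2 := congrArg ℓ (h.sum_frameSeq hn he z)
    simpa [ℓ, map_sum] using h2
  rw [h1, Finset.sum_eq_single ⟨0, by omega⟩]
  · intro k _ hk
    have hk0 : (k : ℕ) ≠ 0 := fun h0 ↦ hk (Fin.ext h0)
    -- Components along the two arguments of the torsion vanish by total skewness; any other `k ≠ 0`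
    -- repeats a vector already in the list.
    by_cases hki : (k : ℕ) = i + 1
    · rw [hki, hz, ht.skew]
      simp [ht.self]
    by_cases hkj : (k : ℕ) = j + 2
    · rw [hkj, hz, ht.inner_cyclic]
      simp [ht.self]
    obtain ⟨a, ha, hak⟩ := exists_skipTwo_eq (p := i + 1) (q := j + 2) (k := 2 * m + 2)
      (by omega) (by omega) (b := k) (by omega) hki hkj
    obtain ⟨l, rfl⟩ : ∃ l, a = l + 1 := ⟨a - 1, by
      have : a ≠ 0 := by rintro rfl; simp [skipTwo] at hak; omega
      omega⟩
    have h2 := congrFun (vecCons_removeNth_removeNth (frameSeq J e) hij) ⟨l + 1, ha⟩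
    rw [← hr] at h2
    rw [W.map_eq_zero_of_eq (i := 0) (j := ⟨l + 1, ha⟩), mul_zero]
    · refine Eq.trans ?_ h2.symm
      simp [hak]
    · exact fun h0 ↦ absurd (congrArg Fin.val h0) (by simp)
  · simp

/-- The double sum collapses to the pairs `e_t, Je_t` with `t ≥ 1`, all with the same coefficient
`C`, and equals `g(ξ, e₀) * C`. -/
lemma alternatization_frameSeq_eq_zero [FiniteDimensional ℝ V] (ht : BismutTorsion g J T)
    (hn : Module.finrank ℝ V = 2 * (m + 2)) (hlee : leeVector J T e = 0)
    {Γ : V →ₗ[ℝ] V →ₗ[ℝ] V} (hΓ : ∀ u v, Γ u v - Γ v u = T u v)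
    {W : V [⋀^Fin (2 * m + 1 + 1)]→ₗ[ℝ] ℝ} (hW : W = wedgeForm (fundamentalForm g J) (m + 1)) :
    AlternatingMap.alternatizeUncurryFin (AlternatingMap.alternatizeUncurryFinLM ∘ₗ
      Γ.compr₂ W.curryLeft) (fun a : Fin (2 * m + 1 + 2) ↦ frameSeq J e (a + 1)) = 0 := by
  rw [AlternatingMap.alternatizeUncurryFin_alternatizeUncurryFinLM_comp_apply]
  set C : ℝ := W fun a ↦ frameSeq J e a with hC
  -- The omitted indices `i + 1` and `j + 2` form a pair `2t, 2t + 1` exactly when `i` is odd and `j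
  -- = i`; the sign is then `(-1)^(2i) = 1`.
  have key : ∀ i : Fin (2 * (m + 1)), ∑ j ≥ (i : Fin (2 * m + 1 + 1)),
      ((-1 : ℤ) ^ (i + j : ℕ) • (g (T (frameSeq J e (i + 1)) (frameSeq J e (j + 2)))
        (frameSeq J e 0) * W (fun a ↦ frameSeq J e (skipTwo (i + 1) (j + 2) a))))
      = if (i : ℕ) % 2 = 1 then g (T (frameSeq J e (i + 1)) (frameSeq J e (i + 2)))
        (frameSeq J e 0) * C else 0 := by
    intro i
    have hz : ∀ j : Fin (2 * m + 1 + 1), (i : ℕ) ≤ j → ((i : ℕ) % 2 = 0 ∨ (j : ℕ) ≠ i) →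
        W (fun a ↦ frameSeq J e (skipTwo (i + 1) (j + 2) a)) = 0 := by
      intro j hij hne
      rw [hW]
      exact wedgeForm_skipTwo_eq_zero h he (by omega) (by omega) (by omega)
    split_ifs with hi
    · rw [Finset.sum_eq_single i]
      · have h2 : W (fun a ↦ frameSeq J e (skipTwo (i + 1) (i + 2) a)) = C := by
          obtain ⟨t, ht'⟩ : ∃ t, (i : ℕ) + 1 = 2 * t := ⟨(i + 1) / 2, by omega⟩
          rw [hC, hW, show (i : ℕ) + 2 = 2 * t + 1 by omega, ht']
          exact wedgeForm_skipTwo_pair h he t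
        rw [h2, ← two_mul]
        simp
      · intro j hj hji
        rw [hz j (Fin.le_def.1 (Finset.mem_Ici.1 hj)) (Or.inr fun h0 ↦ hji (Fin.ext h0))]
        simp
      · simp
    · refine Finset.sum_eq_zero fun j hj ↦ ?_
      rw [hz j (Fin.le_def.1 (Finset.mem_Ici.1 hj)) (Or.inl (by omega))]
      simp
  have h0 : frameSeq J e 0 = e 0 := frameSeq_even J e 0
  have h1 := congrArg (fun u ↦ g u (e 0)) hlee
  simp only [leeVector, map_sum, LinearMap.sum_apply, Fin.sum_univ_succ (n := m + 1), map_add,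
    LinearMap.add_apply, map_zero, LinearMap.zero_apply] at h1
  -- The term of `e₀` itself, `g(T(e₀, Je₀), e₀)`, vanishes by skewness, so the sum over `t ≥ 1` is
  -- all of `g(ξ, e₀)`.
  rw [ht.skew (e 0)] at h1
  simp only [ht.self, map_zero, LinearMap.zero_apply, neg_zero, zero_add] at h1
  calc _ = ∑ i : Fin (2 * (m + 1)), (if (i : ℕ) % 2 = 1 then
        g (T (frameSeq J e (i + 1)) (frameSeq J e (i + 2))) (frameSeq J e 0) * C else 0) := by
        refine Finset.sum_congr rfl fun i _ ↦ ?_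
        rw [← key i]
        refine Finset.sum_congr rfl fun j hj ↦ ?_
        rw [← curryLeft_torsion_frameSeq h he ht hn W (Finset.mem_Ici.1 hj), ← hΓ, map_sub]
        simp
    _ = (∑ t : Fin (m + 1), g (T (e t.succ) (J (e t.succ))) (e 0)) * C := by
        rw [sum_fin_two_mul, Finset.sum_mul]
        refine Finset.sum_congr rfl fun t _ ↦ ?_
        have e1 : frameSeq J e (2 * t + 2) = e t.succ := frameSeq_even J e t.succ
        have e2 : frameSeq J e (2 * t + 3) = J (e t.succ) := frameSeq_odd J e t.succ
        simp [show (2 * (t : ℕ) + 1) % 2 = 1 by omega, add_assoc, e1, e2, h0]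
    _ = 0 := by rw [h1, zero_mul]

end Evaluation

/-- If the Lee vector vanishes, then so does the torsion part of the exterior derivative of the
power `ωⁿ⁻¹` of the fundamental form. -/
theorem alternatization_eq_zero [FiniteDimensional ℝ V] (h : HermitianPair g J)
    (ht : BismutTorsion g J T) {m : ℕ} (hn : Module.finrank ℝ V = 2 * (m + 2))
    (hlee : ∀ e : Fin (m + 2) → V, UnitaryFamily g J e → leeVector J T e = 0)
    {Γ : V →ₗ[ℝ] V →ₗ[ℝ] V} (hΓ : ∀ u v, Γ u v - Γ v u = T u v)
    {W : V [⋀^Fin (2 * m + 1 + 1)]→ₗ[ℝ] ℝ} (hW : W = wedgeForm (fundamentalForm g J) (m + 1))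
    (v : Fin (2 * m + 1 + 2) → V) :
    AlternatingMap.alternatizeUncurryFin (AlternatingMap.alternatizeUncurryFinLM ∘ₗ
      Γ.compr₂ W.curryLeft) v = 0 := by
  -- The `2n - 1` given vectors lie in a hyperplane; its unit normal serves as `e₀` of an adapted
  -- frame.
  obtain ⟨f, hf, hfv⟩ := h.exists_unit_orthogonal v (by simp; omega)
  obtain ⟨e, he, rfl⟩ := h.exists_unitaryFamily hn hf (k := m + 1) le_rfl
  set Φ := AlternatingMap.alternatizeUncurryFin (AlternatingMap.alternatizeUncurryFinLM ∘ₗ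
    Γ.compr₂ W.curryLeft)
  have hb : Φ (fun a : Fin (2 * m + 1 + 2) ↦ frameSeq J e (a + 1)) = 0 :=
    alternatization_frameSeq_eq_zero h he ht hn (hlee e he) hΓ hW
  let L : (Fin (2 * m + 1 + 2) → ℝ) →ₗ[ℝ] V :=
    Fintype.linearCombination ℝ fun a : Fin (2 * m + 1 + 2) ↦ frameSeq J e (a + 1)
  have hL : ∀ i, v i = L fun a ↦ g (v i) (frameSeq J e (a + 1)) := by
    intro i
    have h1 : v i = ∑ k : Fin (2 * m + 1 + 2 + 1), g (v i) (frameSeq J e k) • frameSeq J e k :=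
      h.sum_frameSeq hn he (v i)
    have h0 : frameSeq J e 0 = e 0 := frameSeq_even J e 0
    rw [Fin.sum_univ_succ] at h1
    simp only [Fin.val_zero, h0, h.symm (v i) (e 0), hfv, zero_smul, zero_add] at h1
    exact h1
  -- On the hyperplane the form has top degree, so its value on the frame vectors other than `e₀`
  -- determines it.
  have h2 := AlternatingMap.eq_smul_basis_det (Pi.basisFun ℝ (Fin (2 * m + 1 + 2)))
    (Φ.compLinearMap L)
  have h3 : Φ.compLinearMap L (Pi.basisFun ℝ (Fin (2 * m + 1 + 2))) = 0 := by
    rw [AlternatingMap.compLinearMap_apply, ← hb]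
    congr 1
    funext a
    simp [L, Fintype.linearCombination_apply_single]
  rw [h3, zero_smul] at h2
  have h4 := congrArg (fun F ↦ F fun i a ↦ g (v i) (frameSeq J e (a + 1))) h2
  simp only [AlternatingMap.compLinearMap_apply, AlternatingMap.zero_apply] at h4
  rw [← h4]
  congr 1
  funext i
  exact hL i

end Balanced

/-! ### The exterior derivative of `ωⁿ⁻¹` through the Bismut connection. -/

section BalancedMetric

variable {E : Type*} [NormedAddCommGroup E] [NormedSpace ℝ E]
  {M : Type*} [TopologicalSpace M] [ChartedSpace E M] [IsManifold 𝓘(ℝ, E) ∞ M]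
  [FiniteDimensional ℝ E]
  {S : ComplexStructure E M} {g : Metric E M} {D : Connection E M} {x : M}

/-- The Christoffel symbol of a connection in the chart at `x`: the derivative in the direction `u`
of the constant extension of `v`. -/
def christoffel (D : Connection E M) (x : M) :
    TangentSpace 𝓘(ℝ, E) x →ₗ[ℝ] TangentSpace 𝓘(ℝ, E) x →ₗ[ℝ] TangentSpace 𝓘(ℝ, E) x :=
  LinearMap.mk₂ ℝ (fun u v ↦ D (FiberBundle.extend E v) x u)
    (fun _ _ _ ↦ map_add _ _ _) (fun _ _ _ ↦ map_smul _ _ _)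
    (fun u v w ↦ by
      have hv := (smoothNear_extend v).diffAt
      have hw := (smoothNear_extend w).diffAt
      rw [conn_congr ((smoothNear_extend v).add (smoothNear_extend w)).diffAt
        (eventually_extend_add v w), conn_add hv hw]
      rfl)
    (fun a u v ↦ by
      have hv := (smoothNear_extend v).diffAt
      rw [conn_congr (hv.const_smul a) (eventually_extend_smul a v), conn_const_smul a hv]
      rfl)

/-- This is `∇ω = 0`, a consequence of `∇g = 0` and `∇J = 0`. -/
lemma mvfderiv_kahlerForm (hD : IsBismut S g D) (u v w : TangentSpace 𝓘(ℝ, E) x) :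
    mvfderiv 𝓘(ℝ, E)
        (fun y ↦ kahlerForm S g y (FiberBundle.extend E v y) (FiberBundle.extend E w y)) x u
      = kahlerForm S g x (christoffel D x u v) w + kahlerForm S g x v (christoffel D x u w) := by
  have hv := smoothNear_extend v
  have hw := (smoothNear_extend w).diffAt
  have h1 := hD.metric _ _ x (hv.J S).diffAt hw u
  rw [hD.complex _ x hv.diffAt u] at h1
  simp only [FiberBundle.extend_apply_self] at h1
  exact h1

lemma mvfderiv_wedgePow_kahlerForm (hD : IsBismut S g D) {k : ℕ} (u : TangentSpace 𝓘(ℝ, E) x)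
    (v : Fin (2 * k) → TangentSpace 𝓘(ℝ, E) x) :
    mvfderiv 𝓘(ℝ, E)
        (fun y ↦ wedgePow (kahlerForm S g y) k fun j ↦ FiberBundle.extend E (v j) y) x u
      = ∑ j, wedgeForm (fundamentalForm (bilin (g.inner x)) (S.J x).toLinearMap) k
        (Function.update v j (christoffel D x u (v j))) := by
  let F : Fin (2 * k) → Fin (2 * k) → M → ℝ := fun a b y ↦
    kahlerForm S g y (FiberBundle.extend E (v a) y) (FiberBundle.extend E (v b) y)
  have hF : ∀ a b, HasMFDerivAt 𝓘(ℝ, E) 𝓘(ℝ, ℝ) (F a b) x (mvfderiv 𝓘(ℝ, E) (F a b) x) :=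
    fun a b ↦ (SmoothNear.inner g ((smoothNear_extend (v a)).J S)
      (smoothNear_extend (v b))).mdifferentiableAt.hasMFDerivAt
  have h1 := (HasMFDerivAt.sum (t := Finset.univ) fun (σ : Equiv.Perm (Fin (2 * k))) _ ↦
    (HasMFDerivAt.prod (t := Finset.univ) fun (i : Fin k) _ ↦
      hF (σ ⟨2 * i, by omega⟩) (σ ⟨2 * i + 1, by omega⟩)).const_smul
        ((Equiv.Perm.sign σ : ℤ) : ℝ)).const_smul ((1 / 2 : ℝ) ^ k)
  have h2 : (fun y ↦ wedgePow (kahlerForm S g y) k fun j ↦ FiberBundle.extend E (v j) y)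
      = (1 / 2 : ℝ) ^ k • ∑ σ : Equiv.Perm (Fin (2 * k)), ((Equiv.Perm.sign σ : ℤ) : ℝ) •
        ∏ i : Fin k, F (σ ⟨2 * i, by omega⟩) (σ ⟨2 * i + 1, by omega⟩) := by
    funext y
    simp [wedgePow, F]
  rw [h2, sum_wedgeForm_update]
  have h3 := congrArg (fun L : TangentSpace 𝓘(ℝ, E) x →L[ℝ] ℝ ↦ L u) h1.mfderiv
  refine Eq.trans h3 ?_
  rw [_root_.smul_apply, _root_.sum_apply, smul_eq_mul]
  refine congrArg _ (Finset.sum_congr rfl fun σ _ ↦ congrArg (((Equiv.Perm.sign σ : ℤ) : ℝ) * ·) ?_)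
  let c : Fin k → ℝ := fun i ↦ ∏ j ∈ Finset.univ.erase i,
    F (σ ⟨2 * j, by omega⟩) (σ ⟨2 * j + 1, by omega⟩) x
  let L : Fin k → TangentSpace 𝓘(ℝ, E) x →L[ℝ] ℝ := fun i ↦
    mvfderiv 𝓘(ℝ, E) (F (σ ⟨2 * i, by omega⟩) (σ ⟨2 * i + 1, by omega⟩)) x
  refine (_root_.sum_apply Finset.univ (fun i ↦ c i • L i) u).trans
    (Finset.sum_congr rfl fun i _ ↦ ?_)
  refine congrArg₂ (· * ·) ?_ (mvfderiv_kahlerForm hD u _ _)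
  simp only [c, F, FiberBundle.extend_apply_self]
  rfl

/-- The exterior derivative of a power of the Kähler form as an alternatization. -/
lemma extDerivAt_wedgePow_kahlerForm (hD : IsBismut S g D) {m : ℕ}
    {W : (TangentSpace 𝓘(ℝ, E) x) [⋀^Fin (2 * m + 1 + 1)]→ₗ[ℝ] ℝ}
    (hW : W = wedgeForm (fundamentalForm (bilin (g.inner x)) (S.J x).toLinearMap) (m + 1))
    (v : Fin (2 * m + 1 + 2) → TangentSpace 𝓘(ℝ, E) x) :
    extDerivAt (fun y ↦ wedgePow (kahlerForm S g y) (m + 1)) x v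
      = AlternatingMap.alternatizeUncurryFin (AlternatingMap.alternatizeUncurryFinLM ∘ₗ
        (christoffel D x).compr₂ W.curryLeft) v := by
  rw [AlternatingMap.alternatizeUncurryFin_apply]
  refine Finset.sum_congr rfl fun i _ ↦ ?_
  have h1 := mvfderiv_wedgePow_kahlerForm hD (k := m + 1) (v i) fun j ↦ v (i.succAbove j)
  have h2 := alternatizeUncurryFin_curryLeft_comp W (christoffel D x (v i)) (i.removeNth v)
  rw [h1, ← hW]
  refine (congrArg _ h2.symm).trans ?_
  simp
  rfl

/-- The skew part of the Christoffel symbol is the torsion because constant-coefficient extensions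
commute, so `alternatization_eq_zero` applies at each point. -/
theorem isBalanced_of_leeVector_eq_zero {n : ℕ} (hn : Module.finrank ℝ E = 2 * n)
    (hg : IsHermitian S g) (hD : IsBismut S g D)
    (hlee : ∀ (x : M) (e : Fin n → TangentSpace 𝓘(ℝ, E) x), IsUnitaryFrame S g x e →
      leeVector (S.J x).toLinearMap (bilin (D.torsion x)) e = 0) : IsBalanced n S g := by
  intro x v
  have hfin : FiniteDimensional ℝ (TangentSpace 𝓘(ℝ, E) x) :=
    inferInstanceAs (FiniteDimensional ℝ E)
  match n, hn, hlee, v with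
  -- For `n = 0` and `n = 1` the exponent `n - 1` is `0`, and `ω⁰` is constant.
  | 0, _, _, v => simp [extDerivAt, wedgePow, mvfderiv_const]
  | 1, _, _, v => simp [extDerivAt, wedgePow, mvfderiv_const]
  | m + 2, hn, hlee, v =>
    exact (extDerivAt_wedgePow_kahlerForm hD rfl v).trans
      (alternatization_eq_zero (hg.hermitianPair x) (hD.bismutTorsion x) hn (hlee x)
        (fun u w ↦ (torsion_extend u w).symm) rfl v)

end BalancedMetric

end HermitianGeometry

end

theorem mainTheorem4 {n : ℕ} {E : Type*} [NormedAddCommGroup E] [NormedSpace ℝ E]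
    [FiniteDimensional ℝ E] (hn : Module.finrank ℝ E = 2 * n)
    {M : Type*} [TopologicalSpace M] [T2Space M] [CompactSpace M]
    [ChartedSpace E M] [IsManifold 𝓘(ℝ, E) ∞ M]
    (S : HermitianGeometry.ComplexStructure E M) (g : HermitianGeometry.Metric E M)
    (hg : HermitianGeometry.IsHermitian S g)
    (hBTP : HermitianGeometry.IsBTP S g)
    (hnb : ¬ HermitianGeometry.IsBalanced n S g)
    (α β c : ℝ)
    (hc : HermitianGeometry.HasConstantMixedCurvature n S g α β c) :
    c = 0 := by
  obtain ⟨D, hD, hT⟩ := hBTP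
  by_contra hc0
  exact hnb (HermitianGeometry.isBalanced_of_leeVector_eq_zero hn hg hD fun x e he ↦
    by_contra fun hξ ↦ hc0 (HermitianGeometry.eq_zero_of_leeVector_ne_zero hn hg hD hT hc he hξ))
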